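/- **Setting.** Let $r\in\mathbb R$ and $S,K,\tau,\sigma,\nu>0$ with $\sigma^2\nu<2$. The symmetric Variance Gamma (VG) process $(X_u)_{u\ge 0}$ starts at $0$ and has independent stationary increments (relative to a filtration $(\mathcal F_u)$ under the risk-neutral probability $\mathbb Q$), the increment over a time interval of length $u>0$ being distributed as $\sigma\sqrt{\gamma}\,Z$, where $\gamma$ is Gamma distributed with mean $u$ and variance $\nu u$, and $Z$ is an independent standard normal variable. The asset price is $S_u=S_0\,e^{(r+\omega)u+X_u}$, $S_0>0$, with martingale adjustment $\omega=\frac1\nu\log\!\big(1-\frac{\sigma^2\nu}{2}\big)$. Put $$F=Ke^{-r\tau},\qquad \sigma_\nu=\sigma\sqrt{\nu/2},\qquad k_{\sigma,\nu}=\log\frac SK+r\tau+\omega\tau,\qquad \alpha=\frac{\tau}{\nu}-\frac12,$$ and assume $\alpha\notin\mathbb Z$. **Claim.** For $T=t+\tau$ the payoff $[S_T-K]^+$ is integrable, and the value at time $t$ of the European call, $\mathbb E^{\mathbb Q}\big[e^{-r\tau}[S_T-K]^+\,\big|\,\mathcal F_t\big]$, is almost surely equal to $C(S_t)$, where $$C(S)=e^{-r\tau}\,\mathbb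 E^{\mathbb Q}\Big[\big[S e^{(r+\omega)\tau+X_\tau}-K\big]^+\Big]<\infty .$$ Let $$C^-(k,s)=\frac{F}{2\Gamma(\frac\tau\nu)}\sum_{\substack{n_1\ge 0\\ n_2\ge 1}}\frac{(-1)^{n_1}}{n_1!}\left[\frac{\Gamma(\frac{-n_1+n_2+1}{2}+\alpha)}{\Gamma(\frac{-n_1+n_2}{2}+1)}\Big(\frac{-k}{s}\Big)^{n_1}s^{n_2}+2\,\frac{\Gamma(-2n_1-n_2-1-2\alpha)}{\Gamma(-n_1+\frac12-\alpha)}\Big(\frac{-k}{s}\Big)^{2n_1+1+2\alpha}(-k)^{n_2}\right],$$ where, in the cases where both Gamma functions of a quotient have a pole (which for the second quotient happens only if $2\alpha$ is an odd integer), the quotient is understood as its limit as the parameter tends to $\alpha$, and a quotient is $0$ if only its denominator has a pole. Then: (i) (OTM) If $k_{\sigma,\nu}<0$, the double series $C^-(k_{\sigma,\nu},\sigma_\nu)$ converges absolutely and $C(S)=C^-(k_{\sigma,\nu},\sigma_\nu)$. (ii) (ITM) If $k_{\sigma,\nu}>0$, the double series $C^-(k_{\sigma,\nu},-\sigma_\nu)$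 converges absolutely and $C(S)=S-Ke^{-r\tau}-C^-(k_{\sigma,\nu},-\sigma_\nu)$. (iii) (ATM) If $k_{\sigma,\nu}=0$, the double series $C^-(0,\pm\sigma_\nu)$ and the series below converge absolutely, and $$C(S)=C^-(0,\sigma_\nu)=S-Ke^{-r\tau}-C^-(0,-\sigma_\nu)=\frac{F}{2\Gamma(\frac\tau\nu)}\sum_{n=1}^\infty\frac{\Gamma(\frac{n+1}{2}+\alpha)}{\Gamma(\frac n2+1)}\,\sigma_\nu^{\,n}.$$ -/

import Mathlib

open MeasureTheory ProbabilityTheory Filter Topology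
open scoped NNReal

namespace VarianceGamma

/-- The law at time `t > 0` of the Variance Gamma process with scale `σ`, kurtosis `ν` and
asymmetry `θ`: the law of `θ * γ + σ * √γ * Z`, i.e. of the drifted Brownian motion `θ s + σ W s`
evaluated at an independent time `γ`, where `γ` is Gamma distributed with mean `t` and variance
`ν * t` (shape `t / ν`, rate `1 / ν`) and `Z` is an independent standard normal variable. -/
noncomputable def law (σ ν θ t : ℝ) : Measure ℝ :=
  ((gammaMeasure (t / ν) (1 / ν)).prod (gaussianReal 0 1)).map
    (fun p : ℝ × ℝ => θ * p.1 + σ * √p.1 * p.2)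

/-- `X` is a Variance Gamma process relative to the filtration `ℱ` under `Q`: it is adapted, starts
at zero, and its increments over `[s, t]` are independent of the past `ℱ s` and have the Variance
Gamma law at time `t - s`. (No path regularity is required.) -/
structure IsVGProcess {Ω : Type*} [mΩ : MeasurableSpace Ω] (σ ν θ : ℝ) (Q : Measure Ω)
    (ℱ : Filtration ℝ≥0 mΩ) (X : ℝ≥0 → Ω → ℝ) : Prop where
  adapted : Adapted ℱ X
  zero : X 0 =ᵐ[Q] 0
  indep : ∀ s t : ℝ≥0, s ≤ t →
    Indep (MeasurableSpace.comap (fun w => X t w - X s w) inferInstance) (ℱ s) Q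
  increments : ∀ s t : ℝ≥0, s < t → Q.map (fun w => X t w - X s w) = law σ ν θ ((t : ℝ) - s)

/-- The martingale adjustment `ω`. -/
noncomputable def omega (σ ν θ : ℝ) : ℝ :=
  1 / ν * Real.log (1 - θ * ν - σ ^ 2 * ν / 2)

/-- The asset price `S_u = S₀ exp ((r + ω) u + X_u)` of the exponential Variance Gamma model. -/
noncomputable def stock {Ω : Type*} (σ ν θ r S₀ : ℝ) (X : ℝ≥0 → Ω → ℝ) (u : ℝ≥0) (w : Ω) : ℝ :=
  S₀ * Real.exp ((r + omega σ ν θ) * u + X u w)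

/-- The payoff `[S_T - K]⁺` of the European call. -/
noncomputable def callPayoff (K s : ℝ) : ℝ := max (s - K) 0

/-- The risk-neutral price, at spot `S` and time-to-maturity `τ`, of the claim with terminal
payoff `P`: the discounted expectation of `P (S exp ((r + ω) τ + X))`, with `X` distributed
according to the Variance Gamma law at time `τ`. -/
noncomputable def price (P : ℝ → ℝ) (S r τ σ ν θ : ℝ) : ℝ :=
  Real.exp (-(r * τ)) * ∫ x, P (S * Real.exp ((r + omega σ ν θ) * τ + x)) ∂(law σ ν θ τ)

/-- The forward strike price `F = K exp (-r τ)`. -/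
noncomputable def forwardStrike (K r τ : ℝ) : ℝ := K * Real.exp (-(r * τ))

/-- The rescaled volatility `σ_ν = σ √(ν / 2)`. -/
noncomputable def rescaledVol (σ ν : ℝ) : ℝ := σ * √(ν / 2)

/-- The risk-neutral moneyness `log (S / K) + r τ + ω τ` of the symmetric model. -/
noncomputable def moneyness (S K r τ σ ν : ℝ) : ℝ :=
  Real.log (S / K) + r * τ + omega σ ν 0 * τ

/-- The first Gamma quotient `Γ((-n₁ + n₂ + 1) / 2 + α) / Γ((-n₁ + n₂) / 2 + 1)`. It vanishes when
the denominator has a pole (as `1 / Γ` does), since `Real.Gamma` is `0` at the poles. -/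
noncomputable def quot₁ (α : ℝ) (n₁ n₂ : ℕ) : ℝ :=
  Real.Gamma ((-(n₁ : ℝ) + n₂ + 1) / 2 + α) / Real.Gamma ((-(n₁ : ℝ) + n₂) / 2 + 1)

/-- The second Gamma quotient `Γ(-2 n₁ - n₂ - 1 - 2 α) / Γ(-n₁ + 1 / 2 - α)`. -/
noncomputable def quot₂ (α : ℝ) (n₁ n₂ : ℕ) : ℝ :=
  Real.Gamma (-2 * (n₁ : ℝ) - n₂ - 1 - 2 * α) / Real.Gamma (-(n₁ : ℝ) + 1 / 2 - α)

/-- The value at `α` of the second Gamma quotient, as a function of its parameter continued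
through its removable singularities. When `2 α` is not an integer this is just `quot₂ α n₁ n₂`
(see `coeff₂_eq_quot₂`); when `2 α` is an odd integer, numerator and denominator both have a pole
at `α` and the quotient is their limit. -/
noncomputable def coeff₂ (α : ℝ) (n₁ n₂ : ℕ) : ℝ :=
  limUnder (𝓝[≠] α) (fun a => quot₂ a n₁ n₂)

/-- The term of index `(n₁, n₂)` of the out-of-the-money series at moneyness `k` and rescaled
volatility `s`. -/
noncomputable def otmTerm (α k s : ℝ) (n₁ n₂ : ℕ) : ℝ :=
  (-1) ^ n₁ / (n₁.factorial : ℝ) *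
    (quot₁ α n₁ n₂ * (-k / s) ^ n₁ * s ^ n₂ +
      2 * coeff₂ α n₁ n₂ * (-k / s) ^ (2 * (n₁ : ℝ) + 1 + 2 * α) * (-k) ^ n₂)

/-- The out-of-the-money European call expression `C⁻(k, s)`, the sum being over `n₁ ≥ 0` and
`n₂ ≥ 1` (here `n₂ = p.2 + 1`). -/
noncomputable def otmCall (F α k s : ℝ) : ℝ :=
  F / (2 * Real.Gamma (α + 1 / 2)) * ∑' p : ℕ × ℕ, otmTerm α k s p.1 (p.2 + 1)

/-- The term of index `n` of the at-the-money series. -/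
noncomputable def atmTerm (α s : ℝ) (n : ℕ) : ℝ :=
  Real.Gamma (((n : ℝ) + 1) / 2 + α) / Real.Gamma ((n : ℝ) / 2 + 1) * s ^ n

/-- Away from the half-integers, the second quotient has no poles: it equals the given expression,
which is continuous at every non-integer `a > -1/2`. -/
theorem quot₂_eq {a : ℝ} (ha : ∀ m : ℤ, 2 * a ≠ m) (h : -(1 / 2) < a) (n₁ n₂ : ℕ) :
    quot₂ a n₁ n₂ = (-1) ^ (n₁ + n₂) * Real.Gamma (n₁ + 1 / 2 + a) /
      (2 * Real.sin (Real.pi * a) * Real.Gamma (2 * n₁ + n₂ + 2 + 2 * a)) := by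
  have h1 := Real.Gamma_mul_Gamma_one_sub (2 * (n₁ : ℝ) + n₂ + 2 + 2 * a)
  have h2 := Real.Gamma_mul_Gamma_one_sub ((n₁ : ℝ) + 1 / 2 + a)
  have e1 : 1 - (2 * (n₁ : ℝ) + n₂ + 2 + 2 * a) = -2 * (n₁ : ℝ) - n₂ - 1 - 2 * a := by ring
  have e2 : 1 - ((n₁ : ℝ) + 1 / 2 + a) = -(n₁ : ℝ) + 1 / 2 - a := by ring
  have s1 : Real.sin (Real.pi * (2 * (n₁ : ℝ) + n₂ + 2 + 2 * a))
      = (-1) ^ n₂ * (2 * Real.sin (Real.pi * a) * Real.cos (Real.pi * a)) := by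
    have : Real.pi * (2 * (n₁ : ℝ) + n₂ + 2 + 2 * a)
        = 2 * (Real.pi * a) + ((2 * n₁ + n₂ + 2 : ℕ) : ℝ) * Real.pi := by push_cast; ring
    rw [this, Real.sin_add_nat_mul_pi, Real.sin_two_mul, pow_add, pow_add, pow_mul]
    simp
  have s2 : Real.sin (Real.pi * ((n₁ : ℝ) + 1 / 2 + a))
      = (-1) ^ n₁ * Real.cos (Real.pi * a) := by
    have : Real.pi * ((n₁ : ℝ) + 1 / 2 + a)
        = (Real.pi * a + Real.pi / 2) + (n₁ : ℝ) * Real.pi := by ring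
    rw [this, Real.sin_add_nat_mul_pi, Real.sin_add_pi_div_two]
  have hsc : 2 * Real.sin (Real.pi * a) * Real.cos (Real.pi * a) ≠ 0 := by
    rw [← Real.sin_two_mul]
    intro h0
    obtain ⟨m, hm⟩ := Real.sin_eq_zero_iff.1 h0
    have hpi := Real.pi_ne_zero
    apply ha m
    have : Real.pi * (2 * a - m) = 0 := by linarith
    rcases mul_eq_zero.1 this with h' | h'
    · exact absurd h' hpi
    · linarith
  have hs : Real.sin (Real.pi * a) ≠ 0 := fun h0 => hsc (by simp [h0])
  have hc : Real.cos (Real.pi * a) ≠ 0 := fun h0 => hsc (by simp [h0])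
  have n1 : (0 : ℝ) ≤ n₁ := Nat.cast_nonneg _
  have n2 : (0 : ℝ) ≤ n₂ := Nat.cast_nonneg _
  have g1 : Real.Gamma (2 * (n₁ : ℝ) + n₂ + 2 + 2 * a) ≠ 0 :=
    (Real.Gamma_pos_of_pos (by linarith)).ne'
  have g2 : Real.Gamma ((n₁ : ℝ) + 1 / 2 + a) ≠ 0 := (Real.Gamma_pos_of_pos (by linarith)).ne'
  rw [e1, s1] at h1
  rw [e2, s2] at h2
  have p1 : ((-1 : ℝ) ^ n₁) ≠ 0 := pow_ne_zero _ (by norm_num)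
  have p2 : ((-1 : ℝ) ^ n₂) ≠ 0 := pow_ne_zero _ (by norm_num)
  have q1 : ((-1 : ℝ) ^ n₁) * (-1) ^ n₁ = 1 := by rw [← mul_pow]; simp
  have q2 : ((-1 : ℝ) ^ n₂) * (-1) ^ n₂ = 1 := by rw [← mul_pow]; simp
  have hG1 : Real.Gamma (-2 * (n₁ : ℝ) - n₂ - 1 - 2 * a)
      = Real.pi / ((-1) ^ n₂ * (2 * Real.sin (Real.pi * a) * Real.cos (Real.pi * a)))
        / Real.Gamma (2 * (n₁ : ℝ) + n₂ + 2 + 2 * a) := by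
    rw [← h1, mul_div_cancel_left₀ _ g1]
  have hG2 : Real.Gamma (-(n₁ : ℝ) + 1 / 2 - a)
      = Real.pi / ((-1) ^ n₁ * Real.cos (Real.pi * a)) / Real.Gamma ((n₁ : ℝ) + 1 / 2 + a) := by
    rw [← h2, mul_div_cancel_left₀ _ g2]
  rw [quot₂, hG1, hG2, pow_add]
  have hpi := Real.pi_ne_zero
  have q3 : (((-1 : ℝ) ^ n₂))⁻¹ = (-1) ^ n₂ := inv_eq_of_mul_eq_one_left q2
  generalize Real.Gamma ((n₁ : ℝ) + 1 / 2 + a) = A at *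
  generalize Real.Gamma (2 * (n₁ : ℝ) + n₂ + 2 + 2 * a) = B at *
  generalize Real.cos (Real.pi * a) = c at *
  generalize Real.sin (Real.pi * a) = d at *
  field_simp
  rw [sq, q2]

/-- The limit defining `coeff₂` exists at every non-integer `α > -1/2`. -/
theorem tendsto_quot₂ {α : ℝ} (hα : ∀ m : ℤ, α ≠ m) (h : -(1 / 2) < α) (n₁ n₂ : ℕ) :
    Tendsto (fun a => quot₂ a n₁ n₂) (𝓝[≠] α) (𝓝 (coeff₂ α n₁ n₂)) := by
  refine tendsto_nhds_limUnder ⟨(-1) ^ (n₁ + n₂) * Real.Gamma (n₁ + 1 / 2 + α) /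
      (2 * Real.sin (Real.pi * α) * Real.Gamma (2 * n₁ + n₂ + 2 + 2 * α)), ?_⟩
  have n1 : (0 : ℝ) ≤ n₁ := Nat.cast_nonneg _
  have n2 : (0 : ℝ) ≤ n₂ := Nat.cast_nonneg _
  have hs : Real.sin (Real.pi * α) ≠ 0 := by
    intro h0
    obtain ⟨m, hm⟩ := Real.sin_eq_zero_iff.1 h0
    have : Real.pi * (α - m) = 0 := by linarith
    rcases mul_eq_zero.1 this with h' | h'
    · exact Real.pi_ne_zero h'
    · exact hα m (by linarith)
  have hc : ContinuousAt (fun a : ℝ => (-1) ^ (n₁ + n₂) * Real.Gamma (n₁ + 1 / 2 + a) /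
      (2 * Real.sin (Real.pi * a) * Real.Gamma (2 * n₁ + n₂ + 2 + 2 * a))) α := by
    have c1 : ContinuousAt (fun a : ℝ => Real.Gamma (n₁ + 1 / 2 + a)) α := by
      refine ContinuousAt.comp (g := Real.Gamma) (f := fun a : ℝ => n₁ + 1 / 2 + a) ?_
        (by fun_prop)
      refine (Real.differentiableAt_Gamma fun m => ?_).continuousAt
      have : (0 : ℝ) ≤ m := Nat.cast_nonneg _
      intro h0; linarith
    have c2 : ContinuousAt (fun a : ℝ => Real.Gamma (2 * n₁ + n₂ + 2 + 2 * a)) α := by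
      refine ContinuousAt.comp (g := Real.Gamma) (f := fun a : ℝ => 2 * n₁ + n₂ + 2 + 2 * a) ?_
        (by fun_prop)
      refine (Real.differentiableAt_Gamma fun m => ?_).continuousAt
      have : (0 : ℝ) ≤ m := Nat.cast_nonneg _
      intro h0; linarith
    have c3 : ContinuousAt (fun a : ℝ => Real.sin (Real.pi * a)) α := by fun_prop
    refine (continuousAt_const.mul c1).div ((continuousAt_const.mul c3).mul c2) ?_
    exact mul_ne_zero (mul_ne_zero two_ne_zero hs)
      (Real.Gamma_pos_of_pos (by linarith)).ne'
  refine (hc.tendsto.mono_left nhdsWithin_le_nhds).congr' ?_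
  have hev : ∀ᶠ a : ℝ in 𝓝[≠] α, ∀ m : ℤ, 2 * a ≠ m := by
    by_cases hm : ∃ m : ℤ, 2 * α = m
    · obtain ⟨m, hm⟩ := hm
      have hb : ∀ᶠ a in 𝓝[≠] α, a ∈ Metric.ball α (1 / 2) :=
        nhdsWithin_le_nhds (Metric.ball_mem_nhds α (by norm_num))
      filter_upwards [hb, self_mem_nhdsWithin] with a ha hne l hl
      rw [Metric.mem_ball, Real.dist_eq, abs_lt] at ha
      have l1 : ((l - m : ℤ) : ℝ) < 1 := by push_cast; linarith [ha.2]
      have l2 : (-1 : ℝ) < ((l - m : ℤ) : ℝ) := by push_cast; linarith [ha.1]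
      have l1' : l - m < 1 := by exact_mod_cast l1
      have l2' : -1 < l - m := by exact_mod_cast l2
      have : l = m := by omega
      subst this
      exact hne (by simp only [Set.mem_singleton_iff]; linarith)
    · push Not at hm
      have : Real.sin (2 * α * Real.pi) ≠ 0 := by
        intro h0
        obtain ⟨m, hm'⟩ := Real.sin_eq_zero_iff.1 h0
        exact hm m (mul_right_cancel₀ Real.pi_ne_zero hm').symm
      have hcs : ContinuousAt (fun a : ℝ => Real.sin (2 * a * Real.pi)) α := by fun_prop
      filter_upwards [nhdsWithin_le_nhds (hcs.eventually_ne this)] with a ha m hma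
      exact ha (by rw [hma]; exact Real.sin_int_mul_pi m)
  filter_upwards [hev, nhdsWithin_le_nhds (Ioi_mem_nhds h)] with a ha h'
  exact (quot₂_eq ha h' n₁ n₂).symm

/-- When `2 α` is not an integer, `coeff₂` is the quotient of Gamma values itself. -/
theorem coeff₂_eq_quot₂ {α : ℝ} (hα : ∀ m : ℤ, 2 * α ≠ m) (h : -(1 / 2) < α) (n₁ n₂ : ℕ) :
    coeff₂ α n₁ n₂ = quot₂ α n₁ n₂ := by
  have h1 : ∀ m : ℤ, α ≠ m := fun m hm => hα (2 * m) (by rw [hm]; push_cast; ring)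
  refine tendsto_nhds_unique (tendsto_quot₂ h1 h n₁ n₂) ?_
  refine Tendsto.mono_left (ContinuousAt.tendsto ?_) nhdsWithin_le_nhds
  refine ContinuousAt.div ?_ ?_ (Real.Gamma_ne_zero ?_)
  · refine ContinuousAt.comp (g := Real.Gamma)
      (f := fun a : ℝ => -2 * (n₁ : ℝ) - n₂ - 1 - 2 * a) ?_ (by fun_prop)
    refine (Real.differentiableAt_Gamma fun m h0 => ?_).continuousAt
    exact hα (m - 2 * n₁ - n₂ - 1) (by push_cast; linarith)
  · refine ContinuousAt.comp (g := Real.Gamma)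
      (f := fun a : ℝ => -(n₁ : ℝ) + 1 / 2 - a) ?_ (by fun_prop)
    refine (Real.differentiableAt_Gamma fun m h0 => ?_).continuousAt
    exact hα (2 * m - 2 * n₁ + 1) (by push_cast; linarith)
  · intro m h0
    exact hα (2 * m - 2 * n₁ + 1) (by push_cast; linarith)

/-- The first quotient is continuous in its parameter at every non-integer `α > -1/2`, so its value
is also the limit, including when numerator and denominator both have a pole. -/
theorem continuousAt_quot₁ {α : ℝ} (hα : ∀ m : ℤ, α ≠ m) (h : -(1 / 2) < α) (n₁ n₂ : ℕ) :
    ContinuousAt (fun a => quot₁ a n₁ n₂) α := by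
  by_cases hb : Real.Gamma ((-(n₁ : ℝ) + n₂) / 2 + 1) = 0
  · simp only [quot₁, hb, div_zero]
    exact continuousAt_const
  · refine ContinuousAt.div_const ?_ _
    refine ContinuousAt.comp (g := Real.Gamma)
      (f := fun a : ℝ => (-(n₁ : ℝ) + n₂ + 1) / 2 + a) ?_ (by fun_prop)
    refine (Real.differentiableAt_Gamma fun m h0 => ?_).continuousAt
    rw [Real.Gamma_eq_zero_iff] at hb
    push Not at hb
    rcases Int.even_or_odd' ((n₂ : ℤ) - n₁) with ⟨l, hl | hl⟩
    · have hl' : (n₂ : ℝ) - n₁ = 2 * l := by exact_mod_cast hl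
      rcases lt_or_ge l 0 with hneg | hpos
      · refine hb (-l - 1).toNat ?_
        have : (((-l - 1).toNat : ℤ) : ℝ) = ((-l - 1 : ℤ) : ℝ) := by
          rw [Int.toNat_of_nonneg (by omega)]
        push_cast at this
        rw [this]; linarith
      · have h1 : (0 : ℝ) ≤ l := by exact_mod_cast hpos
        have h2 : (0 : ℝ) ≤ m := Nat.cast_nonneg _
        linarith
    · have hl' : (n₂ : ℝ) - n₁ = 2 * l + 1 := by exact_mod_cast hl
      exact hα (-m - l - 1) (by push_cast; linarith)

end VarianceGamma

/-! A Gaussian variable with Gamma distributed variance has a Bessel density: after rescaling by `s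
= σ √(ν / 2)`, the law of X_τ has density proportional to `besselInt α (x ^ 2 / 4)`
(`law_eq_map_withDensity`). For k = -(y s) and s > 0 the normalised call is therefore the integral
over x > y of (exp (s (x - y)) - 1) times this density, and everything reduces to expanding that
integral.

Expanding the exponential in powers of s leaves the truncated moments ∫_y^∞ (x - y)^n / n! ·
`besselInt α (x ^ 2 / 4)`, that is, ∫_0^∞ minus ∫_0^y. The first integral is a polynomial in y whose
coefficients are Gamma quotients (`integral_pow_mul_besselInt`). In the second, the Bessel integral
is replaced by its expansion at zero (`besselInt_eq`), available because α is not an integer: a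
power series in z plus z^α times another one. Termwise Beta integrals turn the first series into the
remaining coefficients `quot₁` and the second into the coefficients `coeff₂`
(`hasSum_integral_Ioi_sub_pow_mul_besselInt`). The double series converges absolutely because
`quot₁` grows subexponentially and |s| < 1, while `coeff₂` decays factorially (`summable_otmTerm`);
this also justifies all interchanges in `hasSum_otmTerm`.

In the money, symmetry of the density gives the put by the same formula with -s in place of s, and
put-call parity gives the call; the adjustment ω makes the discounted price a martingale, so the
forward term is exactly S. The conditional statement is the freezing lemma for an increment
independent of the past (`condExp_comp_of_indep`). -/

namespace VarianceGamma

/-! ### The Bessel integral: convergence, derivative and reflection of the order. -/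

/-- The integral `∫₀^∞ t ^ (a - 1) * exp (-t - z / t) dt`, equal to
`2 z ^ (a / 2) K_a (2 √z)` with `K_a` the modified Bessel function of the second kind. -/
noncomputable def besselInt (a z : ℝ) : ℝ :=
  ∫ t in Set.Ioi 0, t ^ (a - 1) * Real.exp (-t - z / t)

/-- Since e^x ≥ x^N / N!, the factor e^(-z/t) is worth N powers of t near zero. Choosing N > -a
makes the integral converge for every real order. -/
theorem besselInt_integrand_le {a z t : ℝ} (hz : 0 < z) (ht : 0 < t) (N : ℕ) :
    t ^ (a - 1) * Real.exp (-t - z / t) ≤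
      (N.factorial / z ^ N) * (Real.exp (-t) * t ^ ((a + N) - 1)) := by
  have h1 := Real.pow_div_factorial_le_exp (z / t) (by positivity) N
  have hN : (0 : ℝ) < N.factorial := by positivity
  have h2 : Real.exp (-(z / t)) ≤ N.factorial * t ^ N / z ^ N := by
    rw [Real.exp_neg]
    refine (inv_anti₀ (by positivity) h1).trans (le_of_eq ?_)
    rw [div_pow]; field_simp
  have h3 : t ^ ((a + N) - 1) = t ^ (a - 1) * t ^ N := by
    rw [← Real.rpow_natCast, ← Real.rpow_add ht]; ring_nf
  rw [sub_eq_add_neg (-t), Real.exp_add, h3]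
  calc t ^ (a - 1) * (Real.exp (-t) * Real.exp (-(z / t)))
      ≤ t ^ (a - 1) * (Real.exp (-t) * (N.factorial * t ^ N / z ^ N)) := by gcongr
    _ = _ := by ring

theorem integrableOn_besselInt {a z : ℝ} (hz : 0 < z) :
    IntegrableOn (fun t => t ^ (a - 1) * Real.exp (-t - z / t)) (Set.Ioi 0) := by
  obtain ⟨N, hN⟩ := exists_nat_gt (-a)
  refine Integrable.mono' ((Real.GammaIntegral_convergent (s := a + N) (by linarith)).const_mul
    (N.factorial / z ^ N)) (Measurable.aestronglyMeasurable (by fun_prop)) ?_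
  refine (ae_restrict_iff' measurableSet_Ioi).2 (ae_of_all _ fun t (ht : 0 < t) => ?_)
  rw [Real.norm_of_nonneg (by positivity)]
  exact besselInt_integrand_le hz ht N

theorem besselInt_zero {a : ℝ} (ha : 0 < a) : besselInt a 0 = Real.Gamma a := by
  rw [besselInt, Real.Gamma_eq_integral ha]
  refine setIntegral_congr_fun measurableSet_Ioi fun t _ => ?_
  simp [mul_comm]

theorem besselInt_nonneg (a z : ℝ) : 0 ≤ besselInt a z :=
  setIntegral_nonneg measurableSet_Ioi fun t (ht : 0 < t) => by positivity

theorem measurable_besselInt (a : ℝ) : Measurable (besselInt a) := by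
  unfold besselInt
  refine StronglyMeasurable.measurable ?_
  exact StronglyMeasurable.integral_prod_right
    (f := fun z t : ℝ => t ^ (a - 1) * Real.exp (-t - z / t))
    (Measurable.stronglyMeasurable (by fun_prop))

theorem continuousOn_besselInt {a : ℝ} (ha : 0 < a) : ContinuousOn (besselInt a) (Set.Ici 0) := by
  intro z hz
  refine continuousWithinAt_of_dominated (bound := fun t => Real.exp (-t) * t ^ (a - 1)) ?_ ?_
    (Real.GammaIntegral_convergent ha) ?_
  · exact Eventually.of_forall fun z => Measurable.aestronglyMeasurable (by fun_prop)
  · filter_upwards [self_mem_nhdsWithin] with z (hz : 0 ≤ z)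
    refine (ae_restrict_iff' measurableSet_Ioi).2 (ae_of_all _ fun t (ht : 0 < t) => ?_)
    rw [Real.norm_of_nonneg (by positivity), mul_comm]
    gcongr
    have : 0 ≤ z / t := by positivity
    linarith
  · exact ae_of_all _ fun t => Continuous.continuousWithinAt (by fun_prop)

theorem hasDerivAt_besselInt (a : ℝ) {z : ℝ} (hz : 0 < z) :
    HasDerivAt (besselInt a) (-besselInt (a - 1) z) z := by
  rw [besselInt, ← integral_neg]
  -- On the neighbourhood x > z / 2 the differentiated integrand is dominated by its value at z / 2,
  -- integrable whatever the order.
  refine (hasDerivAt_integral_of_dominated_loc_of_deriv_le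
    (F := fun z t : ℝ => t ^ (a - 1) * Real.exp (-t - z / t))
    (F' := fun z t : ℝ => -(t ^ (a - 1 - 1) * Real.exp (-t - z / t)))
    (bound := fun t => t ^ (a - 1 - 1) * Real.exp (-t - (z / 2) / t))
    (Ioi_mem_nhds (half_lt_self hz)) ?_ (integrableOn_besselInt hz) ?_ ?_
    (integrableOn_besselInt (half_pos hz)) ?_).2
  · exact Eventually.of_forall fun z => Measurable.aestronglyMeasurable (by fun_prop)
  · exact Measurable.aestronglyMeasurable (by fun_prop)
  · refine (ae_restrict_iff' measurableSet_Ioi).2 (ae_of_all _ fun t (ht : 0 < t) x hx => ?_)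
    rw [norm_neg, Real.norm_of_nonneg (by positivity)]
    have : z / 2 ≤ x := le_of_lt hx
    gcongr
  · refine (ae_restrict_iff' measurableSet_Ioi).2 (ae_of_all _ fun t (ht : 0 < t) x hx => ?_)
    have h1 : HasDerivAt (fun x : ℝ => -t - x / t) (-(1 / t)) x := by
      simpa using ((hasDerivAt_id x).div_const t).const_sub (-t)
    refine (h1.exp.const_mul (t ^ (a - 1))).congr_deriv ?_
    rw [Real.rpow_sub_one ht.ne' (a - 1)]
    ring

/-- The substitution t ↦ z / t exchanges the two terms of the exponent. It is carried out as an
inversion followed by a scaling by z⁻¹. -/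
theorem besselInt_neg (a : ℝ) {z : ℝ} (hz : 0 < z) :
    besselInt (-a) z = z ^ (-a) * besselInt a z := by
  have e1 := integral_comp_rpow_Ioi (fun t : ℝ => t ^ (-a - 1) * Real.exp (-t - z / t))
    (p := -1) (by norm_num)
  have e2 := integral_comp_mul_left_Ioi
    (fun x : ℝ => (|(-1 : ℝ)| * x ^ ((-1 : ℝ) - 1)) •
      ((x ^ (-1 : ℝ)) ^ (-a - 1) * Real.exp (-x ^ (-1 : ℝ) - z / x ^ (-1 : ℝ)))) 0
    (inv_pos.2 hz)
  rw [mul_zero, e1, inv_inv, smul_eq_mul] at e2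
  have e3 : besselInt (-a) z = z⁻¹ * (z * besselInt (-a) z) := by field_simp
  rw [e3, besselInt, ← e2, besselInt, ← integral_const_mul, ← integral_const_mul]
  refine setIntegral_congr_fun measurableSet_Ioi fun t (ht : 0 < t) => ?_
  have hx : 0 < z⁻¹ * t := by positivity
  have h1 : (z⁻¹ * t) ^ (-1 : ℝ) = z / t := by
    rw [Real.rpow_neg_one]; field_simp
  have h2 : (z⁻¹ * t) ^ ((-1 : ℝ) - 1) = z ^ 2 / t ^ 2 := by
    rw [show (-1 : ℝ) - 1 = ((-2 : ℤ) : ℝ) by norm_num, Real.rpow_intCast]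
    simp [zpow_neg, mul_pow, zpow_ofNat]; field_simp
  have h3 : (z / t) ^ (-a - 1) = z ^ (-a) * z⁻¹ * (t ^ (a - 1) * t ^ 2) := by
    rw [Real.div_rpow hz.le ht.le, Real.rpow_sub_one hz.ne', div_eq_mul_inv,
      ← Real.rpow_neg ht.le, ← Real.rpow_natCast t 2, ← Real.rpow_add ht, div_eq_mul_inv]
    congr 2; push_cast; ring
  have h4 : -(z / t) - z / (z / t) = -t - z / t := by field_simp; ring
  simp only [h1, h2, h3, h4, abs_neg, abs_one, smul_eq_mul]
  field_simp

/-! ### The candidate expansion at zero, with the same derivative and reflection rules. -/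

/-- The entire series `∑ Γ(a - j) (-z)^j / j!`. -/
noncomputable def gammaSeries (a z : ℝ) : ℝ :=
  ∑' j : ℕ, Real.Gamma (a - j) * (-z) ^ j / j.factorial

theorem Gamma_sub_nat_succ {a : ℝ} (ha : ∀ m : ℤ, a ≠ m) (j : ℕ) :
    Real.Gamma (a - j) = (a - j - 1) * Real.Gamma (a - (j + 1 : ℕ)) := by
  have h : a - (j + 1 : ℕ) ≠ 0 := fun h => ha (j + 1 : ℕ) (by push_cast at *; linarith)
  have := Real.Gamma_add_one h
  push_cast at *
  rw [show a - j - 1 = a - (j + 1) by ring, ← this]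
  ring_nf

theorem Gamma_sub_nat_ne_zero {a : ℝ} (ha : ∀ m : ℤ, a ≠ m) (j : ℕ) :
    Real.Gamma (a - j) ≠ 0 :=
  Real.Gamma_ne_zero fun m h => ha (j - m) (by push_cast; linarith)

/-- The ratio of successive terms is |z| / (|a - j - 1| (j + 1)), which tends to zero.
Non-integrality of a keeps all the Gamma values finite and nonzero. -/
theorem summable_gammaSeries {a : ℝ} (ha : ∀ m : ℤ, a ≠ m) (z : ℝ) :
    Summable fun j : ℕ => Real.Gamma (a - j) * z ^ j / j.factorial := by
  rcases eq_or_ne z 0 with rfl | hz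
  · refine summable_of_ne_finset_zero (s := {0}) fun j hj => ?_
    simp at hj; simp [hj]
  refine summable_of_ratio_test_tendsto_lt_one (l := 0) zero_lt_one ?_ ?_
  · refine Eventually.of_forall fun j => ?_
    have := Gamma_sub_nat_ne_zero ha j
    positivity
  · have e : ∀ j : ℕ, ‖Real.Gamma (a - (j + 1 : ℕ)) * z ^ (j + 1) / (j + 1).factorial‖ /
        ‖Real.Gamma (a - j) * z ^ j / j.factorial‖ = |z| * (|a - j - 1|⁻¹ * ((j : ℝ) + 1)⁻¹) := by
      intro j
      have h0 := Gamma_sub_nat_ne_zero ha (j + 1)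
      have h1 : a - j - 1 ≠ 0 := fun h => ha (j + 1 : ℕ) (by push_cast; linarith)
      rw [Gamma_sub_nat_succ ha j, ← norm_div, Nat.factorial_succ]
      have : (Real.Gamma (a - (j + 1 : ℕ)) * z ^ (j + 1) / ((j + 1) * j.factorial : ℕ)) /
          ((a - j - 1) * Real.Gamma (a - (j + 1 : ℕ)) * z ^ j / j.factorial)
          = z * ((a - j - 1)⁻¹ * ((j : ℝ) + 1)⁻¹) := by
        push_cast at *
        field_simp
        ring
      rw [this, norm_mul, norm_mul, norm_inv, norm_inv, Real.norm_eq_abs, Real.norm_eq_abs,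
        Real.norm_eq_abs, abs_of_nonneg (show (0 : ℝ) ≤ (j : ℝ) + 1 by positivity)]
    simp_rw [e]
    rw [show (0 : ℝ) = |z| * (0 * 0) by ring]
    refine Tendsto.const_mul _ (Tendsto.mul ?_ ?_)
    · refine tendsto_inv_atTop_zero.comp (tendsto_abs_atBot_atTop.comp ?_)
      refine tendsto_atBot_add_const_right _ _ ?_
      exact tendsto_const_nhds.add_atBot (tendsto_neg_atTop_atBot.comp tendsto_natCast_atTop_atTop)
    · exact tendsto_inv_atTop_zero.comp
        (tendsto_atTop_add_const_right _ _ tendsto_natCast_atTop_atTop)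

theorem hasDerivAt_gammaSeries {a : ℝ} (ha : ∀ m : ℤ, a ≠ m) (z : ℝ) :
    HasDerivAt (gammaSeries a) (-gammaSeries (a - 1) z) z := by
  have ha1 : ∀ m : ℤ, a - 1 ≠ m := fun m h => ha (m + 1) (by push_cast; linarith)
  set R := |z| + 1 with hR
  -- The factor j cancels against j!, so the differentiated series is the series of order a - 1
  -- shifted by one index; at R it bounds the derivatives uniformly on the ball.
  have hb : Summable fun j : ℕ => ‖Real.Gamma (a - j) * (j * R ^ (j - 1)) / j.factorial‖ := by
    rw [← summable_nat_add_iff 1]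
    refine ((summable_gammaSeries ha1 R).norm).congr fun j => ?_
    rw [Nat.factorial_succ]
    push_cast
    rw [show a - (j + 1 : ℝ) = a - 1 - j by ring]
    congr 1
    field_simp
  have key := hasDerivAt_tsum_of_isPreconnected (t := Metric.ball (0 : ℝ) R) (y₀ := z) (y := z)
    (g := fun (j : ℕ) (z : ℝ) => Real.Gamma (a - j) * (-z) ^ j / j.factorial)
    (g' := fun (j : ℕ) (z : ℝ) => Real.Gamma (a - j) * (j * (-z) ^ (j - 1) * (-1)) / j.factorial)
    hb Metric.isOpen_ball (convex_ball _ _).isPreconnected ?_ ?_ ?_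
    (summable_gammaSeries ha (-z)) ?_
  · refine key.congr_deriv ?_
    rw [gammaSeries, ← tsum_neg, Summable.tsum_eq_zero_add]
    · simp only [CharP.cast_eq_zero, zero_mul, mul_zero, zero_div, zero_add]
      refine tsum_congr fun j => ?_
      rw [Nat.factorial_succ]
      push_cast
      rw [show a - (j + 1 : ℝ) = a - 1 - j by ring]
      field_simp
    · refine Summable.of_norm_bounded hb fun j => ?_
      simp only [norm_mul, norm_div, norm_pow, norm_neg, norm_one, mul_one]
      gcongr
      simp only [hR, Real.norm_eq_abs]
      rw [abs_of_nonneg (by positivity : 0 ≤ |z| + 1)]; linarith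
  · intro j y _
    exact (((hasDerivAt_neg y).pow j).const_mul _).div_const _
  · intro j y hy
    simp only [norm_mul, norm_div, norm_pow, norm_neg, norm_one, mul_one]
    rw [mem_ball_zero_iff] at hy
    gcongr
    exact hy.le.trans (le_abs_self R)
  · simp [hR]
  · simp [hR]

theorem hasDerivAt_rpow_mul_gammaSeries {a : ℝ} (ha : ∀ m : ℤ, a ≠ m) {z : ℝ} (hz : 0 < z) :
    HasDerivAt (fun z => z ^ a * gammaSeries (-a) z)
      (-(z ^ (a - 1) * gammaSeries (1 - a) z)) z := by
  have hna : ∀ m : ℤ, -a ≠ m := fun m h => ha (-m) (by push_cast; linarith)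
  have hna1 : ∀ m : ℤ, -a - 1 ≠ m := fun m h => ha (-m - 1) (by push_cast; linarith)
  have h1a : ∀ m : ℤ, 1 - a ≠ m := fun m h => ha (-m + 1) (by push_cast; linarith)
  have s0 := summable_gammaSeries hna (-z)
  have s1 := (summable_gammaSeries hna1 (-z)).mul_left z
  have s2 := summable_gammaSeries h1a (-z)
  -- Termwise this is (a + j) Γ(-a - j) = -Γ(1 - a - j), once the factor z has been absorbed by an
  -- index shift.
  have key : a * gammaSeries (-a) z - z * gammaSeries (-a - 1) z = -gammaSeries (1 - a) z := by
    simp only [gammaSeries]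
    have s1' : Summable fun j : ℕ => j * (Real.Gamma (-a - j) * (-z) ^ j / j.factorial) := by
      rw [← summable_nat_add_iff 1]
      refine s1.neg.congr fun j => ?_
      rw [Nat.factorial_succ]
      push_cast
      rw [show -a - (j + 1 : ℝ) = -a - 1 - j by ring]
      field_simp
      ring
    have e1 : z * ∑' j : ℕ, Real.Gamma (-a - 1 - j) * (-z) ^ j / j.factorial
        = -∑' j : ℕ, j * (Real.Gamma (-a - j) * (-z) ^ j / j.factorial) := by
      rw [s1'.tsum_eq_zero_add, ← tsum_mul_left]
      simp only [CharP.cast_eq_zero, zero_mul, zero_add]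
      rw [← tsum_neg]
      refine tsum_congr fun j => ?_
      rw [Nat.factorial_succ]
      push_cast
      rw [show -a - (j + 1 : ℝ) = -a - 1 - j by ring]
      field_simp
      ring
    rw [e1, sub_neg_eq_add, ← tsum_mul_left, ← (s0.mul_left a).tsum_add s1', ← tsum_neg]
    refine tsum_congr fun j => ?_
    have := Gamma_sub_nat_succ h1a j
    rw [this]
    push_cast
    rw [show 1 - a - (j + 1 : ℝ) = -a - j by ring]
    ring
  have hp := (Real.hasDerivAt_rpow_const (x := z) (p := a) (Or.inl hz.ne')).mul
    (hasDerivAt_gammaSeries hna z)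
  refine hp.congr_deriv ?_
  rw [← mul_neg, ← key, show z ^ a = z ^ (a - 1) * z by rw [Real.rpow_sub_one hz.ne']; field_simp]
  ring

/-- The expansion at zero of `besselInt a`. -/
noncomputable def besselSeries (a z : ℝ) : ℝ :=
  gammaSeries a z + z ^ a * gammaSeries (-a) z

theorem hasDerivAt_besselSeries {a : ℝ} (ha : ∀ m : ℤ, a ≠ m) {z : ℝ} (hz : 0 < z) :
    HasDerivAt (besselSeries a) (-besselSeries (a - 1) z) z := by
  refine ((hasDerivAt_gammaSeries ha z).add
    (hasDerivAt_rpow_mul_gammaSeries ha hz)).congr_deriv ?_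
  rw [besselSeries, neg_sub]
  ring

theorem besselSeries_neg (a : ℝ) {z : ℝ} (hz : 0 < z) :
    besselSeries (-a) z = z ^ (-a) * besselSeries a z := by
  have : z ^ (-a) * z ^ a = 1 := by rw [← Real.rpow_add hz]; simp
  rw [besselSeries, besselSeries, neg_neg, mul_add, ← mul_assoc, this]
  ring

theorem besselSeries_zero {a : ℝ} (ha : 0 < a) : besselSeries a 0 = Real.Gamma a := by
  rw [besselSeries, Real.zero_rpow ha.ne', gammaSeries, tsum_eq_single 0]
  · simp
  · intro j hj
    simp [hj]

theorem continuousOn_besselSeries {a : ℝ} (h0 : 0 < a) (ha : ∀ m : ℤ, a ≠ m) :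
    ContinuousOn (besselSeries a) (Set.Ici 0) := by
  have hna : ∀ m : ℤ, -a ≠ m := fun m h => ha (-m) (by push_cast; linarith)
  have c1 : Continuous (gammaSeries a) :=
    continuous_iff_continuousAt.2 fun z => (hasDerivAt_gammaSeries ha z).continuousAt
  have c2 : Continuous (gammaSeries (-a)) :=
    continuous_iff_continuousAt.2 fun z => (hasDerivAt_gammaSeries hna z).continuousAt
  exact (c1.add ((Real.continuous_rpow_const h0.le).mul c2)).continuousOn

/-! ### Uniqueness for the differential system, and the expansion of the Bessel integral. -/

/-- A solution of `u' = -z ^ (a - 1) v`, `v' = -z ^ (-a) u` that vanishes at `0` is zero. -/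
theorem eq_zero_of_hasDerivAt_bessel_system {a : ℝ} (h0 : 0 < a) (h1 : a < 1) {u v : ℝ → ℝ}
    (hu : ContinuousOn u (Set.Ici 0)) (hv : ContinuousOn v (Set.Ici 0)) (hu0 : u 0 = 0)
    (hv0 : v 0 = 0) (hu' : ∀ z, 0 < z → HasDerivAt u (-(z ^ (a - 1) * v z)) z)
    (hv' : ∀ z, 0 < z → HasDerivAt v (-(z ^ (-a) * u z)) z) {z : ℝ} (hz : 0 ≤ z) : u z = 0 := by
  -- Here w' = z^(a-1) + z^(-a) is the sum of the two coefficients of the system, and w is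
  -- continuous at 0 because 0 < a < 1. With this weight, E' = -w' (u + v)² e^(-w) ≤ 0, so the
  -- nonnegative E cannot leave its initial value 0.
  set w : ℝ → ℝ := fun z => z ^ a / a + z ^ (1 - a) / (1 - a) with hw
  set E : ℝ → ℝ := fun z => (u z ^ 2 + v z ^ 2) * Real.exp (-w z) with hE
  have hwc : Continuous w :=
    ((Real.continuous_rpow_const h0.le).div_const _).add
      ((Real.continuous_rpow_const (by linarith)).div_const _)
  have hEc : ContinuousOn E (Set.Ici 0) :=
    ((hu.pow 2).add (hv.pow 2)).mul (Real.continuous_exp.comp hwc.neg).continuousOn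
  have hEd : ∀ z, 0 < z → HasDerivAt E
      (-((z ^ (a - 1) + z ^ (-a)) * (u z + v z) ^ 2 * Real.exp (-w z))) z := by
    intro z hz
    have d1 : HasDerivAt w (z ^ (a - 1) + z ^ (-a)) z := by
      have e1 := (Real.hasDerivAt_rpow_const (x := z) (p := a) (Or.inl hz.ne')).div_const a
      have e2 := (Real.hasDerivAt_rpow_const (x := z) (p := 1 - a) (Or.inl hz.ne')).div_const
        (1 - a)
      refine (e1.add e2).congr_deriv ?_
      have : 1 - a ≠ 0 := by linarith
      rw [mul_div_cancel_left₀ _ h0.ne', mul_div_cancel_left₀ _ this]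
      congr 2; ring
    refine ((((hu' z hz).pow 2).add ((hv' z hz).pow 2)).mul d1.neg.exp).congr_deriv ?_
    simp only [Pi.add_apply, Pi.pow_apply, Pi.neg_apply]
    push_cast
    ring
  have hanti : AntitoneOn E (Set.Ici 0) := by
    refine antitoneOn_of_deriv_nonpos (convex_Ici 0) hEc ?_ ?_
    · rw [interior_Ici]
      exact fun z hz => (hEd z hz).differentiableAt.differentiableWithinAt
    · rw [interior_Ici]
      intro z hz
      rw [(hEd z hz).deriv]
      have : (0 : ℝ) < z := hz
      have : 0 ≤ (z ^ (a - 1) + z ^ (-a)) * (u z + v z) ^ 2 * Real.exp (-w z) := by positivity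
      linarith
  have hle := hanti Set.self_mem_Ici hz hz
  have hE0 : E 0 = 0 := by simp [hE, hu0, hv0]
  rw [hE0] at hle
  have hsq : u z ^ 2 + v z ^ 2 ≤ 0 := by
    by_contra hcon
    push Not at hcon
    exact absurd hle (not_le.2 (mul_pos hcon (Real.exp_pos _)))
  nlinarith [sq_nonneg (u z), sq_nonneg (v z)]

/-- The derivative lowers the order to a - 1, which reflection turns into 1 - a. So the errors at
orders a and 1 - a form a closed system, and both vanish at zero because integral and series there
take the same Gamma value. -/
theorem besselInt_eq_of_mem_Ioo {a : ℝ} (h0 : 0 < a) (h1 : a < 1) {z : ℝ} (hz : 0 ≤ z) :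
    besselInt a z = besselSeries a z := by
  have ha : ∀ m : ℤ, a ≠ m := by
    intro m hm
    rw [hm] at h0 h1
    have : 0 < m := by exact_mod_cast h0
    have : m < 1 := by exact_mod_cast h1
    omega
  have ha' : ∀ m : ℤ, 1 - a ≠ m := fun m h => ha (1 - m) (by push_cast; linarith)
  have h2 : 0 < 1 - a := by linarith
  refine sub_eq_zero.1 (eq_zero_of_hasDerivAt_bessel_system h0 h1
    (u := fun z => besselInt a z - besselSeries a z)
    (v := fun z => besselInt (1 - a) z - besselSeries (1 - a) z)
    ((continuousOn_besselInt h0).sub (continuousOn_besselSeries h0 ha))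
    ((continuousOn_besselInt h2).sub (continuousOn_besselSeries h2 ha'))
    (by simp only [besselInt_zero h0, besselSeries_zero h0, sub_self])
    (by simp only [besselInt_zero h2, besselSeries_zero h2, sub_self]) ?_ ?_ hz)
  · intro z hz
    refine ((hasDerivAt_besselInt a hz).sub (hasDerivAt_besselSeries ha hz)).congr_deriv ?_
    rw [show a - 1 = -(1 - a) by ring, besselInt_neg _ hz, besselSeries_neg _ hz]
    ring
  · intro z hz
    refine ((hasDerivAt_besselInt _ hz).sub (hasDerivAt_besselSeries ha' hz)).congr_deriv ?_
    rw [show 1 - a - 1 = -a by ring, besselInt_neg _ hz, besselSeries_neg _ hz]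
    ring

/-- The error at order a + 1 has derivative minus the error at order a, hence zero; it is constant
and vanishes at the origin. -/
theorem besselInt_add_one_eq {a : ℝ} (h0 : 0 < a) (ha : ∀ m : ℤ, a ≠ m)
    (h : ∀ z, 0 ≤ z → besselInt a z = besselSeries a z) {z : ℝ} (hz : 0 ≤ z) :
    besselInt (a + 1) z = besselSeries (a + 1) z := by
  have ha1 : ∀ m : ℤ, a + 1 ≠ m := fun m h => ha (m - 1) (by push_cast; linarith)
  have h1 : 0 < a + 1 := by linarith
  have hd : ∀ x, 0 < x →
      HasDerivAt (fun z => besselInt (a + 1) z - besselSeries (a + 1) z) 0 x := by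
    intro x hx
    refine ((hasDerivAt_besselInt _ hx).sub (hasDerivAt_besselSeries ha1 hx)).congr_deriv ?_
    rw [add_sub_cancel_right, h x hx.le]
    ring
  have hc := (continuousOn_besselInt h1).sub (continuousOn_besselSeries h1 ha1)
  rcases hz.eq_or_lt with rfl | hz
  · rw [besselInt_zero h1, besselSeries_zero h1]
  obtain ⟨c, hc1, hc2⟩ := exists_hasDerivAt_eq_slope
    (fun z => besselInt (a + 1) z - besselSeries (a + 1) z) (fun _ => 0) hz
    (hc.mono Set.Icc_subset_Ici_self) (fun x hx => hd x hx.1)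
  simp only [besselInt_zero h1, besselSeries_zero h1, sub_self, sub_zero] at hc2
  have := (div_eq_zero_iff.1 hc2.symm).resolve_right hz.ne'
  linarith

theorem besselInt_eq_of_pos {a : ℝ} (h0 : 0 < a) (ha : ∀ m : ℤ, a ≠ m) {z : ℝ} (hz : 0 ≤ z) :
    besselInt a z = besselSeries a z := by
  have key : ∀ (n : ℕ) (b : ℝ), 0 < b → b < 1 → ∀ z, 0 ≤ z →
      besselInt (b + n) z = besselSeries (b + n) z := by
    intro n b hb0 hb1
    induction n with
    | zero => simpa using fun z hz => besselInt_eq_of_mem_Ioo hb0 hb1 hz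
    | succ n ih =>
      intro z hz
      have hb : ∀ m : ℤ, b + n ≠ m := by
        intro m hm
        have e : b = ((m - n : ℤ) : ℝ) := by push_cast; linarith
        rw [e] at hb0 hb1
        have : 0 < m - n := by exact_mod_cast hb0
        have : m - n < 1 := by exact_mod_cast hb1
        omega
      push_cast
      rw [← add_assoc]
      exact besselInt_add_one_eq (by positivity) hb ih hz
  have e : a = Int.fract a + ⌊a⌋₊ := by
    rw [natCast_floor_eq_intCast_floor h0.le]
    exact (Int.fract_add_floor a).symm
  rw [e]
  refine key _ _ (lt_of_le_of_ne (Int.fract_nonneg a) ?_) (Int.fract_lt_one a) z hz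
  intro h
  exact ha ⌊a⌋ (by conv_lhs => rw [← Int.fract_add_floor a, ← h, zero_add])

/-- The expansion of the Bessel integral for non-integer order. -/
theorem besselInt_eq {a : ℝ} (ha : ∀ m : ℤ, a ≠ m) {z : ℝ} (hz : 0 < z) :
    besselInt a z = besselSeries a z := by
  rcases lt_trichotomy a 0 with h | h | h
  · have hna : ∀ m : ℤ, -a ≠ m := fun m h => ha (-m) (by push_cast; linarith)
    rw [← neg_neg a, besselInt_neg _ hz, besselSeries_neg _ hz,
      besselInt_eq_of_pos (by linarith) hna hz.le]
  · exact absurd h (by exact_mod_cast ha 0)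
  · exact besselInt_eq_of_pos h ha hz.le

/-! ### Moments of the Bessel integral on the half-line. -/

theorem integrableOn_pow_mul_exp_neg_mul_sq (m : ℕ) {b : ℝ} (hb : 0 < b) :
    IntegrableOn (fun x : ℝ => x ^ m * Real.exp (-b * x ^ 2)) (Set.Ioi 0) := by
  have := integrableOn_rpow_mul_exp_neg_mul_sq hb (s := m) (by
    have : (0 : ℝ) ≤ m := Nat.cast_nonneg _
    linarith)
  simpa using this

theorem integral_pow_mul_exp_neg_mul_sq (m : ℕ) {b : ℝ} (hb : 0 < b) :
    ∫ x in Set.Ioi (0 : ℝ), x ^ m * Real.exp (-b * x ^ 2) =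
      b ^ (-((m : ℝ) + 1) / 2) * (1 / 2) * Real.Gamma (((m : ℝ) + 1) / 2) := by
  have := integral_rpow_mul_exp_neg_mul_rpow (p := 2) (q := m) (b := b) (by norm_num) (by
    have : (0 : ℝ) ≤ m := Nat.cast_nonneg _
    linarith) hb
  rw [← this]
  refine setIntegral_congr_fun measurableSet_Ioi fun x _ => ?_
  norm_num

theorem integral_pow_mul_besselInt_integrand (a : ℝ) (m : ℕ) {t : ℝ} (ht : 0 < t) :
    ∫ x in Set.Ioi (0 : ℝ), x ^ m * (t ^ (a - 1) * Real.exp (-t - x ^ 2 / 4 / t)) =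
      2 ^ m * Real.Gamma (((m : ℝ) + 1) / 2) *
        (Real.exp (-t) * t ^ (((m : ℝ) + 1) / 2 + a - 1)) := by
  have h := integral_pow_mul_exp_neg_mul_sq m (b := 1 / (4 * t)) (by positivity)
  have e : ∀ x : ℝ, x ^ m * (t ^ (a - 1) * Real.exp (-t - x ^ 2 / 4 / t)) =
      t ^ (a - 1) * Real.exp (-t) * (x ^ m * Real.exp (-(1 / (4 * t)) * x ^ 2)) := by
    intro x
    rw [sub_eq_add_neg (-t), Real.exp_add]
    have : -(x ^ 2 / 4 / t) = -(1 / (4 * t)) * x ^ 2 := by field_simp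
    rw [this]; ring
  simp_rw [e]
  rw [integral_const_mul, h]
  have h4 : (1 / (4 * t)) ^ (-((m : ℝ) + 1) / 2) = 2 ^ (m + 1) * t ^ (((m : ℝ) + 1) / 2) := by
    rw [one_div, Real.inv_rpow (by positivity), ← Real.rpow_neg (by positivity),
      show -(-((m : ℝ) + 1) / 2) = ((m : ℝ) + 1) / 2 by ring,
      Real.mul_rpow (by norm_num) ht.le, show (4 : ℝ) = 2 ^ (2 : ℝ) by norm_num,
      ← Real.rpow_mul (by norm_num), show 2 * (((m : ℝ) + 1) / 2) = ((m + 1 : ℕ) : ℝ) by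
        push_cast; ring, Real.rpow_natCast]
  rw [h4, show ((m : ℝ) + 1) / 2 + a - 1 = ((m : ℝ) + 1) / 2 + (a - 1) by ring, Real.rpow_add ht]
  ring

/-- Integrating the Gaussian in x first leaves a Gamma integrand of order (m + 1) / 2 + a. Its
positivity at m = 0 is exactly the hypothesis on a. -/
theorem integrable_pow_mul_besselInt_integrand {a : ℝ} (ha : -(1 / 2) < a) (m : ℕ) :
    Integrable (Function.uncurry fun t x : ℝ =>
      x ^ m * (t ^ (a - 1) * Real.exp (-t - x ^ 2 / 4 / t)))
      ((volume.restrict (Set.Ioi 0)).prod (volume.restrict (Set.Ioi 0))) := by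
  have hm : (0 : ℝ) ≤ m := Nat.cast_nonneg _
  refine (integrable_prod_iff (Measurable.aestronglyMeasurable (by
    unfold Function.uncurry; fun_prop))).2 ⟨?_, ?_⟩
  · refine (ae_restrict_iff' measurableSet_Ioi).2 (ae_of_all _ fun t (ht : 0 < t) => ?_)
    refine ((integrableOn_pow_mul_exp_neg_mul_sq m (b := 1 / (4 * t))
      (by positivity)).const_mul (t ^ (a - 1) * Real.exp (-t))).congr (ae_of_all _ fun x => ?_)
    simp only [Function.uncurry]
    rw [sub_eq_add_neg (-t), Real.exp_add]
    have : -(x ^ 2 / 4 / t) = -(1 / (4 * t)) * x ^ 2 := by field_simp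
    rw [this]; ring
  · refine ((Real.GammaIntegral_convergent (s := ((m : ℝ) + 1) / 2 + a)
      (by linarith)).const_mul (2 ^ m * Real.Gamma (((m : ℝ) + 1) / 2))).congr ?_
    refine (ae_restrict_iff' measurableSet_Ioi).2 (ae_of_all _ fun t (ht : 0 < t) => ?_)
    simp only [Function.uncurry]
    rw [← integral_pow_mul_besselInt_integrand a m ht]
    refine setIntegral_congr_fun measurableSet_Ioi fun x (hx : 0 < x) => ?_
    rw [Real.norm_of_nonneg (by positivity)]

theorem integrableOn_pow_mul_besselInt {a : ℝ} (ha : -(1 / 2) < a) (m : ℕ) :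
    IntegrableOn (fun x => x ^ m * besselInt a (x ^ 2 / 4)) (Set.Ioi 0) := by
  refine (integrable_pow_mul_besselInt_integrand ha m).integral_prod_right.congr
    (ae_of_all _ fun x => ?_)
  simp only [Function.uncurry, besselInt]
  rw [integral_const_mul]

theorem integral_pow_mul_besselInt {a : ℝ} (ha : -(1 / 2) < a) (m : ℕ) :
    ∫ x in Set.Ioi (0 : ℝ), x ^ m * besselInt a (x ^ 2 / 4) =
      √Real.pi * m.factorial * (Real.Gamma (((m : ℝ) + 1) / 2 + a) /
        Real.Gamma ((m : ℝ) / 2 + 1)) := by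
  have hm : (0 : ℝ) ≤ m := Nat.cast_nonneg _
  have e : ∀ x : ℝ, x ^ m * besselInt a (x ^ 2 / 4) = ∫ t in Set.Ioi (0 : ℝ),
      x ^ m * (t ^ (a - 1) * Real.exp (-t - x ^ 2 / 4 / t)) := fun x => by
    rw [integral_const_mul]; rfl
  simp_rw [e]
  rw [← integral_integral_swap (integrable_pow_mul_besselInt_integrand ha m),
    setIntegral_congr_fun measurableSet_Ioi
      (fun t (ht : 0 < t) => integral_pow_mul_besselInt_integrand a m ht),
    integral_const_mul, ← Real.Gamma_eq_integral (by linarith)]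
  -- Legendre duplication turns 2^m Γ((m + 1) / 2) into √π m! / Γ(m / 2 + 1), producing the
  -- denominator of `quot₁`.
  have hd := Real.Gamma_mul_Gamma_add_half (((m : ℝ) + 1) / 2)
  have hg : Real.Gamma ((m : ℝ) / 2 + 1) ≠ 0 := (Real.Gamma_pos_of_pos (by positivity)).ne'
  rw [show ((m : ℝ) + 1) / 2 + 1 / 2 = (m : ℝ) / 2 + 1 by ring,
    show 2 * (((m : ℝ) + 1) / 2) = (m : ℝ) + 1 by ring, Real.Gamma_nat_eq_factorial,
    show 1 - ((m : ℝ) + 1) = -(m : ℝ) by ring, Real.rpow_neg (by norm_num),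
    Real.rpow_natCast] at hd
  have : Real.Gamma (((m : ℝ) + 1) / 2) = m.factorial * (2 ^ m)⁻¹ * √Real.pi /
      Real.Gamma ((m : ℝ) / 2 + 1) := by
    rw [eq_div_iff hg, hd]
  rw [this]
  field_simp

/-! ### Termwise Riemann-Liouville integration on a bounded interval. -/

/-- The Riemann-Liouville integral of a power. -/
theorem integral_sub_pow_mul_rpow {b y : ℝ} (hb : -1 < b) (hy : 0 < y) (n : ℕ) :
    ∫ u in Set.Ioc 0 y, (y - u) ^ n / n.factorial * u ^ b =
      y ^ (b + n + 1) * (Real.Gamma (b + 1) / Real.Gamma (b + n + 2)) := by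
  have hn : (0 : ℝ) ≤ n := Nat.cast_nonneg _
  -- The scaled Beta integral is a complex identity with real entries; taking real parts brings it
  -- back to ℝ.
  have h1 := Complex.betaIntegral_scaled ((b + 1 : ℝ) : ℂ) ((n + 1 : ℝ) : ℂ) hy
  have h2 := beta_eq_betaIntegralReal (b + 1) (n + 1) (by linarith) (by linarith)
  have h3 : (∫ x in (0 : ℝ)..y, (x : ℂ) ^ (((b + 1 : ℝ) : ℂ) - 1) *
      ((y : ℂ) - x) ^ (((n + 1 : ℝ) : ℂ) - 1)) =
      ((∫ x in (0 : ℝ)..y, x ^ b * (y - x) ^ n : ℝ) : ℂ) := by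
    rw [← intervalIntegral.integral_ofReal]
    refine intervalIntegral.integral_congr fun x hx => ?_
    rw [Set.uIcc_of_le hy.le] at hx
    have e1 : (((b + 1 : ℝ) : ℂ) - 1) = (b : ℂ) := by push_cast; ring
    have e2 : (((n + 1 : ℝ) : ℂ) - 1) = (n : ℂ) := by push_cast; ring
    simp only [e1, e2, Complex.cpow_natCast]
    rw [Complex.ofReal_mul, Complex.ofReal_cpow hx.1]
    push_cast
    rfl
  rw [h3] at h1
  have h4 := congrArg Complex.re h1
  rw [Complex.ofReal_re] at h4
  have h5 : ((y : ℂ) ^ (((b + 1 : ℝ) : ℂ) + ((n + 1 : ℝ) : ℂ) - 1)) =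
      ((y ^ (b + n + 1) : ℝ) : ℂ) := by
    rw [Complex.ofReal_cpow hy.le]; congr 1; push_cast; ring
  rw [h5, Complex.re_ofReal_mul, ← h2] at h4
  rw [← intervalIntegral.integral_of_le hy.le]
  have e : ∀ u : ℝ, (y - u) ^ n / n.factorial * u ^ b =
      (n.factorial : ℝ)⁻¹ * (u ^ b * (y - u) ^ n) := fun u => by ring
  simp_rw [e]
  rw [intervalIntegral.integral_const_mul, h4, ProbabilityTheory.beta,
    Real.Gamma_nat_eq_factorial, show b + 1 + ((n : ℝ) + 1) = b + n + 2 by ring]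
  field_simp

theorem integrableOn_sub_pow_mul_rpow {b : ℝ} (hb : -1 < b) (y : ℝ) (n : ℕ) :
    IntegrableOn (fun u => (y - u) ^ n / n.factorial * u ^ b) (Set.Ioc 0 y) := by
  rcases le_total 0 y with hy | hy
  · have h := intervalIntegral.intervalIntegrable_rpow' hb (a := 0) (b := y)
    rw [← intervalIntegrable_iff_integrableOn_Ioc_of_le hy]
    exact h.continuousOn_mul (Continuous.continuousOn (by fun_prop))
  · simp [Set.Ioc_eq_empty (not_lt.2 hy)]

theorem hasSum_integral_sub_pow_mul_series {b y : ℝ} (hb : -1 < b) (hy : 0 ≤ y) (n : ℕ)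
    {c : ℕ → ℝ} (hc : Summable fun j => |c j| * y ^ (2 * j)) :
    HasSum (fun j : ℕ => c j * (y ^ (2 * (j : ℝ) + b + n + 1) *
      (Real.Gamma (2 * j + b + 1) / Real.Gamma (2 * j + b + n + 2))))
      (∫ u in Set.Ioc 0 y, (y - u) ^ n / n.factorial * ∑' j : ℕ, c j * u ^ (2 * (j : ℝ) + b)) := by
  have hn : (0 : ℝ) ≤ n := Nat.cast_nonneg _
  rcases hy.eq_or_lt with rfl | hy
  · simp only [Set.Ioc_self, Measure.restrict_empty, integral_zero_measure]
    convert hasSum_zero with j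
    have hj : (0 : ℝ) ≤ j := Nat.cast_nonneg _
    rw [Real.zero_rpow (by linarith)]
    simp
  have hbj : ∀ j : ℕ, -1 < 2 * (j : ℝ) + b := fun j => by
    have hj : (0 : ℝ) ≤ j := Nat.cast_nonneg _
    linarith
  set F : ℕ → ℝ → ℝ := fun j u => c j * ((y - u) ^ n / n.factorial * u ^ (2 * (j : ℝ) + b))
  have hint : ∀ j, Integrable (F j) (volume.restrict (Set.Ioc 0 y)) := fun j =>
    (integrableOn_sub_pow_mul_rpow (hbj j) y n).const_mul _
  have hI : IntegrableOn (fun u => (y - u) ^ n / n.factorial * u ^ b) (Set.Ioc 0 y) :=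
    integrableOn_sub_pow_mul_rpow hb y n
  -- Bounding u^(2j) by y^(2j) leaves one fixed integral times the summable |c j| y^(2j).
  have hsum : Summable fun j => ∫ u in Set.Ioc 0 y, ‖F j u‖ := by
    refine Summable.of_nonneg_of_le (fun j => integral_nonneg fun u => norm_nonneg _) (fun j => ?_)
      (hc.mul_right (∫ u in Set.Ioc 0 y, (y - u) ^ n / n.factorial * u ^ b))
    rw [← integral_const_mul]
    refine setIntegral_mono_on (hint j).norm (hI.const_mul _) measurableSet_Ioc fun u hu => ?_
    have hu0 : 0 < u := hu.1
    have hyu : 0 ≤ y - u := sub_nonneg.2 hu.2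
    have e : ‖F j u‖ = |c j| * u ^ (2 * j) * ((y - u) ^ n / n.factorial * u ^ b) := by
      simp only [F]
      rw [norm_mul, Real.norm_eq_abs, Real.norm_of_nonneg (by positivity), Real.rpow_add hu0]
      rw [show 2 * (j : ℝ) = ((2 * j : ℕ) : ℝ) by push_cast; ring, Real.rpow_natCast]
      ring
    rw [e]
    gcongr
    exact hu.2
  have key := hasSum_integral_of_summable_integral_norm hint hsum
  have e1 : ∀ j, ∫ u in Set.Ioc 0 y, F j u = c j * (y ^ (2 * (j : ℝ) + b + n + 1) *
      (Real.Gamma (2 * j + b + 1) / Real.Gamma (2 * j + b + n + 2))) := fun j => by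
    rw [integral_const_mul, integral_sub_pow_mul_rpow (hbj j) hy]
  have e2 : ∫ u in Set.Ioc 0 y, ∑' j, F j u = ∫ u in Set.Ioc 0 y,
      (y - u) ^ n / n.factorial * ∑' j : ℕ, c j * u ^ (2 * (j : ℝ) + b) := by
    refine setIntegral_congr_fun measurableSet_Ioc fun u _ => ?_
    simp only [F]
    rw [← tsum_mul_left]
    exact tsum_congr fun j => by ring
  rw [← e2]
  exact key.congr_fun fun j => (e1 j).symm

/-! ### Gamma quotients and the series of the truncated moments. -/

/-- Near α, but away from it, 2a is never an integer, so `quot₂_eq` applies there. Its right-hand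
side is continuous at α, including when 2α is an odd integer. -/
theorem coeff₂_eq {α : ℝ} (hα : ∀ m : ℤ, α ≠ m) (h : -(1 / 2) < α) (n₁ n₂ : ℕ) :
    coeff₂ α n₁ n₂ = (-1) ^ (n₁ + n₂) * Real.Gamma (n₁ + 1 / 2 + α) /
      (2 * Real.sin (Real.pi * α) * Real.Gamma (2 * n₁ + n₂ + 2 + 2 * α)) := by
  have n1 : (0 : ℝ) ≤ n₁ := Nat.cast_nonneg _
  have n2 : (0 : ℝ) ≤ n₂ := Nat.cast_nonneg _
  have hΓ : ∀ x : ℝ, 0 < x → ContinuousAt Real.Gamma x := fun x hx =>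
    (Real.differentiableAt_Gamma fun m h0 => by
      have : (0 : ℝ) ≤ m := Nat.cast_nonneg _
      linarith).continuousAt
  have hs : Real.sin (Real.pi * α) ≠ 0 := by
    intro h0
    obtain ⟨m, hm⟩ := Real.sin_eq_zero_iff.1 h0
    exact hα m (mul_left_cancel₀ Real.pi_ne_zero (by linarith))
  have hc : ContinuousAt (fun a : ℝ => (-1) ^ (n₁ + n₂) * Real.Gamma (n₁ + 1 / 2 + a) /
      (2 * Real.sin (Real.pi * a) * Real.Gamma (2 * n₁ + n₂ + 2 + 2 * a))) α := by
    have c1 : ContinuousAt (fun a : ℝ => Real.Gamma (n₁ + 1 / 2 + a)) α :=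
      ContinuousAt.comp (g := Real.Gamma) (f := fun a : ℝ => n₁ + 1 / 2 + a)
        (hΓ _ (by linarith)) (by fun_prop)
    have c2 : ContinuousAt (fun a : ℝ => Real.Gamma (2 * n₁ + n₂ + 2 + 2 * a)) α :=
      ContinuousAt.comp (g := Real.Gamma) (f := fun a : ℝ => 2 * n₁ + n₂ + 2 + 2 * a)
        (hΓ _ (by linarith)) (by fun_prop)
    have c3 : ContinuousAt (fun a : ℝ => 2 * Real.sin (Real.pi * a)) α := by fun_prop
    exact (continuousAt_const.mul c1).div (c3.mul c2)
      (mul_ne_zero (mul_ne_zero two_ne_zero hs) (Real.Gamma_pos_of_pos (by linarith)).ne')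
  refine tendsto_nhds_unique (tendsto_quot₂ hα h n₁ n₂)
    ((hc.tendsto.mono_left nhdsWithin_le_nhds).congr' ?_)
  have hev : ∀ᶠ a : ℝ in 𝓝[≠] α, Real.sin (2 * a * Real.pi) ≠ 0 := by
    have hd : HasDerivAt (fun a : ℝ => Real.sin (2 * a * Real.pi))
        (Real.cos (2 * α * Real.pi) * (2 * 1 * Real.pi)) α :=
      ((((hasDerivAt_id α).const_mul 2).mul_const Real.pi)).sin
    by_cases h0 : Real.sin (2 * α * Real.pi) = 0
    -- The zeros of the sine are simple, hence isolated.
    · refine hd.eventually_ne (mul_ne_zero ?_ (by positivity))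
      intro h1
      have := Real.sin_sq_add_cos_sq (2 * α * Real.pi)
      simp [h0, h1] at this
    · exact nhdsWithin_le_nhds (hd.continuousAt.eventually_ne h0)
  filter_upwards [hev, nhdsWithin_le_nhds (Ioi_mem_nhds h)] with a ha h'
  exact (quot₂_eq (fun m hm => ha (by rw [hm]; exact Real.sin_int_mul_pi m)) h' n₁ n₂).symm

theorem Gamma_half_sub_nat (l : ℕ) :
    Real.Gamma (1 / 2 - l) * (2 * l).factorial = (-4) ^ l * l.factorial * √Real.pi := by
  induction l with
  | zero => simpa using Real.Gamma_one_half_eq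
  | succ l ih =>
    have h0 : (0 : ℝ) ≤ l := Nat.cast_nonneg _
    have h : (1 / 2 : ℝ) - (l + 1 : ℕ) ≠ 0 := by
      push_cast
      intro h
      linarith
    have h1 := Real.Gamma_add_one h
    rw [show (1 / 2 : ℝ) - (l + 1 : ℕ) + 1 = 1 / 2 - l by push_cast; ring] at h1
    rw [h1] at ih
    rw [show 2 * (l + 1) = (2 * l + 1) + 1 by ring, Nat.factorial_succ, Nat.factorial_succ,
      Nat.factorial_succ, pow_succ]
    push_cast at *
    linear_combination (-4 * ((l : ℝ) + 1)) * ih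

/-- Beyond the diagonal the quotient depends on the parity of n₁ - n₂: odd differences carry the
coefficients of `gammaSeries α`, while even ones put the denominator at a pole and vanish. -/
theorem quot₁_add_odd (α : ℝ) (n l : ℕ) :
    quot₁ α (2 * l + (n + 1)) n = Real.Gamma (α - l) / Real.Gamma (1 / 2 - l) := by
  rw [quot₁]
  push_cast
  congr 2 <;> ring

theorem quot₁_add_even (α : ℝ) (n l : ℕ) : quot₁ α (2 * l + 1 + (n + 1)) n = 0 := by
  rw [quot₁]
  have : (-((2 * l + 1 + (n + 1) : ℕ) : ℝ) + n) / 2 + 1 = -(l : ℝ) := by push_cast; ring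
  rw [this, Real.Gamma_neg_nat_eq_zero, div_zero]

theorem quot₁_sub (α : ℝ) {n i : ℕ} (hi : i ≤ n) : quot₁ α i n =
    Real.Gamma (((n - i : ℕ) + 1 : ℝ) / 2 + α) / Real.Gamma (((n - i : ℕ) : ℝ) / 2 + 1) := by
  rw [quot₁, Nat.cast_sub hi]
  congr 2 <;> ring

theorem integrableOn_sub_pow_mul_besselInt {α : ℝ} (h : -(1 / 2) < α) (y : ℝ) (n : ℕ) :
    IntegrableOn (fun x => (x - y) ^ n / n.factorial * besselInt α (x ^ 2 / 4)) (Set.Ioi 0) := by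
  have e : ∀ x : ℝ, (x - y) ^ n / n.factorial * besselInt α (x ^ 2 / 4) =
      ∑ i ∈ Finset.range (n + 1), (-y) ^ i * n.choose i / n.factorial *
        (x ^ (n - i) * besselInt α (x ^ 2 / 4)) := by
    intro x
    rw [show x - y = -y + x by ring, add_pow, Finset.sum_div, Finset.sum_mul]
    exact Finset.sum_congr rfl fun i _ => by ring
  simp_rw [e]
  exact integrable_finsetSum _ fun i _ => (integrableOn_pow_mul_besselInt h _).const_mul _

/-- The binomial formula and the full moments supply exactly the `quot₁` terms of index i ≤ n. -/
theorem integral_Ioi_zero_sub_pow_mul_besselInt {α : ℝ} (h : -(1 / 2) < α) (y : ℝ) (n : ℕ) :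
    ∫ x in Set.Ioi 0, (x - y) ^ n / n.factorial * besselInt α (x ^ 2 / 4) =
      √Real.pi * ∑ i ∈ Finset.range (n + 1),
        (-1) ^ i / (i.factorial : ℝ) * (quot₁ α i n * y ^ i) := by
  have e : ∀ x : ℝ, (x - y) ^ n / n.factorial * besselInt α (x ^ 2 / 4) =
      ∑ i ∈ Finset.range (n + 1), (-y) ^ i * n.choose i / n.factorial *
        (x ^ (n - i) * besselInt α (x ^ 2 / 4)) := by
    intro x
    rw [show x - y = -y + x by ring, add_pow, Finset.sum_div, Finset.sum_mul]
    exact Finset.sum_congr rfl fun i _ => by ring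
  simp_rw [e]
  rw [integral_finsetSum _ fun i _ => (integrableOn_pow_mul_besselInt h _).const_mul _,
    Finset.mul_sum]
  refine Finset.sum_congr rfl fun i hi => ?_
  have hi : i ≤ n := by simpa [Nat.lt_succ_iff] using hi
  rw [integral_const_mul, integral_pow_mul_besselInt h, quot₁_sub α hi, Nat.cast_choose ℝ hi,
    neg_pow y]
  have := Nat.factorial_ne_zero
  field_simp

theorem summable_abs_gammaSeries_coeff {a : ℝ} (ha : ∀ m : ℤ, a ≠ m) (c y : ℝ) :
    Summable fun j : ℕ =>
      |c * (Real.Gamma (a - j) * (-1) ^ j / (4 ^ j * j.factorial))| * y ^ (2 * j) := by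
  refine ((summable_gammaSeries ha (y ^ 2 / 4)).norm.mul_left |c|).congr fun j => ?_
  have h4 : (0 : ℝ) < 4 ^ j * j.factorial := by positivity
  rw [abs_mul, mul_assoc]
  congr 1
  simp only [norm_mul, norm_div, norm_pow, Real.norm_eq_abs, abs_mul, abs_div, abs_pow, abs_neg,
    abs_one, one_pow, mul_one, sq_abs]
  rw [div_pow, pow_mul, abs_of_pos (by norm_num : (0 : ℝ) < 4),
    abs_of_nonneg (by positivity : (0 : ℝ) ≤ j.factorial)]
  field_simp

/-- The Bessel expansion is inserted at u² / 4. The exponents 2j + 0 and 2j + 2α are written so that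
one termwise integration lemma serves both series, and (1/4)^α comes from (u² / 4)^α. -/
theorem integral_Ioc_sub_pow_mul_besselInt {α : ℝ} (hα : ∀ m : ℤ, α ≠ m) (h : -(1 / 2) < α)
    (y : ℝ) (n : ℕ) :
    ∫ x in Set.Ioc 0 y, (x - y) ^ n / n.factorial * besselInt α (x ^ 2 / 4) =
      (-1) ^ n * ((∫ u in Set.Ioc 0 y, (y - u) ^ n / n.factorial *
        ∑' j : ℕ, (1 * (Real.Gamma (α - j) * (-1) ^ j / (4 ^ j * j.factorial))) *
          u ^ (2 * (j : ℝ) + 0)) +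
      ∫ u in Set.Ioc 0 y, (y - u) ^ n / n.factorial *
        ∑' j : ℕ, ((1 / 4) ^ α * (Real.Gamma (-α - j) * (-1) ^ j / (4 ^ j * j.factorial))) *
          u ^ (2 * (j : ℝ) + 2 * α)) := by
  have e1 : ∀ u : ℝ, ∑' j : ℕ, (1 * (Real.Gamma (α - j) * (-1) ^ j / (4 ^ j * j.factorial))) *
      u ^ (2 * (j : ℝ) + 0) = gammaSeries α (u ^ 2 / 4) := by
    intro u
    refine tsum_congr fun j => ?_
    rw [add_zero, show 2 * (j : ℝ) = ((2 * j : ℕ) : ℝ) by push_cast; ring, Real.rpow_natCast,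
      neg_pow (u ^ 2 / 4), div_pow, pow_mul]
    field_simp
  have e2 : ∀ u : ℝ, 0 < u →
      ∑' j : ℕ, ((1 / 4) ^ α * (Real.Gamma (-α - j) * (-1) ^ j / (4 ^ j * j.factorial))) *
        u ^ (2 * (j : ℝ) + 2 * α) = besselInt α (u ^ 2 / 4) - gammaSeries α (u ^ 2 / 4) := by
    intro u hu
    rw [besselInt_eq hα (by positivity), besselSeries, add_sub_cancel_left, gammaSeries,
      ← tsum_mul_left]
    refine tsum_congr fun j => ?_
    have : (u ^ 2 / 4) ^ α = (1 / 4) ^ α * u ^ (2 * α) := by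
      rw [show u ^ 2 / 4 = (1 / 4) * u ^ 2 by ring, Real.mul_rpow (by norm_num) (by positivity),
        ← Real.rpow_natCast u 2, ← Real.rpow_mul hu.le]
      norm_num
    rw [this, Real.rpow_add hu, show 2 * (j : ℝ) = ((2 * j : ℕ) : ℝ) by push_cast; ring,
      Real.rpow_natCast, neg_pow (u ^ 2 / 4), div_pow, pow_mul]
    field_simp
  have hB : IntegrableOn (fun u => (y - u) ^ n / n.factorial * besselInt α (u ^ 2 / 4))
      (Set.Ioc 0 y) := by
    refine (((integrableOn_sub_pow_mul_besselInt h y n).mono_set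
      Set.Ioc_subset_Ioi_self).const_mul ((-1) ^ n)).congr (ae_of_all _ fun u => ?_)
    simp only
    rw [show y - u = (-1) * (u - y) by ring, mul_pow]
    ring
  have hG : IntegrableOn (fun u => (y - u) ^ n / n.factorial * gammaSeries α (u ^ 2 / 4))
      (Set.Ioc 0 y) := by
    have c1 : Continuous (gammaSeries α) :=
      continuous_iff_continuousAt.2 fun z => (hasDerivAt_gammaSeries hα z).continuousAt
    have : Continuous fun u : ℝ => (y - u) ^ n / n.factorial * gammaSeries α (u ^ 2 / 4) := by
      fun_prop
    exact (this.integrableOn_Icc (a := 0) (b := y)).mono_set Set.Ioc_subset_Icc_self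
  simp_rw [e1]
  have hK : (∫ u in Set.Ioc 0 y, (y - u) ^ n / n.factorial *
      ∑' j : ℕ, ((1 / 4) ^ α * (Real.Gamma (-α - j) * (-1) ^ j / (4 ^ j * j.factorial))) *
        u ^ (2 * (j : ℝ) + 2 * α)) =
      ∫ u in Set.Ioc 0 y, ((y - u) ^ n / n.factorial * besselInt α (u ^ 2 / 4) -
        (y - u) ^ n / n.factorial * gammaSeries α (u ^ 2 / 4)) :=
    setIntegral_congr_fun measurableSet_Ioc fun u hu => by simp only [e2 u hu.1, mul_sub]
  rw [hK, integral_sub hB hG, add_sub_cancel,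
    ← integral_const_mul]
  refine setIntegral_congr_fun measurableSet_Ioc fun u _ => ?_
  rw [show u - y = (-1) * (y - u) by ring, mul_pow]
  ring

/-- Duplication at j + 1/2 + α combined with reflection at -α - j. It converts the integrated
coefficients of the second series into the closed form of `coeff₂`. -/
theorem Gamma_neg_sub_nat_mul {α : ℝ} (hα : ∀ m : ℤ, α ≠ m) (j : ℕ) :
    (1 / 4) ^ α * Real.Gamma (-α - j) / 4 ^ j * Real.Gamma (2 * j + 2 * α + 1) =
      -(√Real.pi * (-1) ^ j * Real.Gamma (j + 1 / 2 + α) / Real.sin (Real.pi * α)) := by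
  have hd := Real.Gamma_mul_Gamma_add_half ((j : ℝ) + 1 / 2 + α)
  have hr := Real.Gamma_mul_Gamma_one_sub (-α - (j : ℝ))
  have hs : Real.sin (Real.pi * α) ≠ 0 := by
    intro h0
    obtain ⟨m, hm⟩ := Real.sin_eq_zero_iff.1 h0
    exact hα m (mul_left_cancel₀ Real.pi_ne_zero (by linarith))
  have e : Real.sin (Real.pi * (-α - j)) = -((-1) ^ j * Real.sin (Real.pi * α)) := by
    rw [show Real.pi * (-α - j) = -(Real.pi * α + j * Real.pi) by ring, Real.sin_neg,
      Real.sin_add_nat_mul_pi]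
  rw [e, show 1 - (-α - (j : ℝ)) = j + 1 / 2 + α + 1 / 2 by ring] at hr
  have e2 : (2 : ℝ) ^ (1 - 2 * ((j : ℝ) + 1 / 2 + α)) = (1 / 4) ^ α / 4 ^ j := by
    rw [show (1 : ℝ) / 4 = 2 ^ (-2 : ℝ) by
        rw [Real.rpow_neg (by norm_num)]; norm_num, ← Real.rpow_mul (by norm_num),
      show 1 - 2 * ((j : ℝ) + 1 / 2 + α) = -2 * α - ((2 * j : ℕ) : ℝ) by push_cast; ring,
      Real.rpow_sub (by norm_num), Real.rpow_natCast, pow_mul]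
    norm_num
  rw [e2, show 2 * ((j : ℝ) + 1 / 2 + α) = 2 * j + 2 * α + 1 by ring] at hd
  have hpi : √Real.pi ≠ 0 := by positivity
  have hpp : √Real.pi * √Real.pi = Real.pi := Real.mul_self_sqrt Real.pi_pos.le
  have q2 : ((-1 : ℝ) ^ j) * (-1) ^ j = 1 := by rw [← mul_pow]; simp
  have hne : ((-1 : ℝ) ^ j) ≠ 0 := pow_ne_zero _ (by norm_num)
  refine mul_right_cancel₀ hpi ?_
  have hr' : Real.Gamma (-α - j) * Real.Gamma (j + 1 / 2 + α + 1 / 2) =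
      -(Real.pi * (-1) ^ j / Real.sin (Real.pi * α)) := by
    rw [hr, div_neg, neg_inj, div_eq_div_iff (mul_ne_zero hne hs) hs]
    linear_combination (-Real.pi * Real.sin (Real.pi * α)) * q2
  calc _ = Real.Gamma (-α - j) * (Real.Gamma (2 * j + 2 * α + 1) * ((1 / 4) ^ α / 4 ^ j) *
          √Real.pi) := by ring
    _ = Real.Gamma (j + 1 / 2 + α) * (Real.Gamma (-α - j) *
          Real.Gamma (j + 1 / 2 + α + 1 / 2)) := by rw [← hd]; ring
    _ = _ := by
      rw [hr']
      linear_combination (Real.Gamma (j + 1 / 2 + α) * (-1) ^ j / Real.sin (Real.pi * α)) * hpp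

/-- The series expansion of the truncated moments of the Bessel density. -/
theorem hasSum_integral_Ioi_sub_pow_mul_besselInt {α y : ℝ} (hα : ∀ m : ℤ, α ≠ m)
    (h : -(1 / 2) < α) (hy : 0 ≤ y) (n : ℕ) :
    HasSum (fun j : ℕ => (-1) ^ j / (j.factorial : ℝ) * (quot₁ α j n * y ^ j +
      2 * coeff₂ α j n * y ^ (2 * (j : ℝ) + 1 + 2 * α) * y ^ n))
      ((√Real.pi)⁻¹ * ∫ x in Set.Ioi y,
        (x - y) ^ n / n.factorial * besselInt α (x ^ 2 / 4)) := by
  have hpi : √Real.pi ≠ 0 := by positivity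
  have hna : ∀ m : ℤ, -α ≠ m := fun m h => hα (-m) (by push_cast; linarith)
  have H1 := hasSum_integral_sub_pow_mul_series (b := 0) (by norm_num) hy n
    (summable_abs_gammaSeries_coeff hα 1 y)
  have H2 := hasSum_integral_sub_pow_mul_series (b := 2 * α) (by linarith) hy n
    (summable_abs_gammaSeries_coeff hna ((1 / 4) ^ α) y)
  have hI := integral_Ioc_sub_pow_mul_besselInt hα h y n
  set I₁ := ∫ u in Set.Ioc 0 y, (y - u) ^ n / n.factorial *
        ∑' j : ℕ, (1 * (Real.Gamma (α - j) * (-1) ^ j / (4 ^ j * j.factorial))) *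
          u ^ (2 * (j : ℝ) + 0)
  set I₂ := ∫ u in Set.Ioc 0 y, (y - u) ^ n / n.factorial *
        ∑' j : ℕ, ((1 / 4) ^ α * (Real.Gamma (-α - j) * (-1) ^ j / (4 ^ j * j.factorial))) *
          u ^ (2 * (j : ℝ) + 2 * α)
  set P : ℕ → ℝ := fun j => (-1) ^ j / (j.factorial : ℝ) * (quot₁ α j n * y ^ j) with hP
  -- The tail j ≥ n + 1 is split by the parity of j - (n + 1): even offsets come from I₁, odd ones
  -- are zero. The sign joins the (-1)^n of (x - y)^n to the minus of subtracting ∫_0^y.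
  have K1 : HasSum (fun l => P (2 * l + (n + 1))) ((√Real.pi)⁻¹ * (-1) ^ (n + 1) * I₁) := by
    refine (H1.mul_left ((√Real.pi)⁻¹ * (-1) ^ (n + 1))).congr_fun fun l => Eq.symm ?_
    simp only [hP]
    rw [quot₁_add_odd]
    have hg := Gamma_half_sub_nat l
    have hg0 : Real.Gamma (1 / 2 - l) ≠ 0 := by
      intro h0
      rw [h0, zero_mul] at hg
      have : ((-4 : ℝ) ^ l * l.factorial * √Real.pi) ≠ 0 := by positivity
      exact this hg.symm
    have hG : (Real.Gamma (1 / 2 - l))⁻¹ =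
        (2 * l).factorial / ((-4) ^ l * l.factorial * √Real.pi) := by
      rw [← hg]; field_simp
    have f1 : Real.Gamma (2 * (l : ℝ) + 0 + 1) = (2 * l).factorial := by
      rw [← Real.Gamma_nat_eq_factorial]; congr 1; push_cast; ring
    have f2 : Real.Gamma (2 * (l : ℝ) + 0 + n + 2) = (2 * l + (n + 1)).factorial := by
      rw [← Real.Gamma_nat_eq_factorial]; congr 1; push_cast; ring
    have f3 : y ^ (2 * (l : ℝ) + 0 + n + 1) = y ^ (2 * l + (n + 1)) := by
      rw [← Real.rpow_natCast]; congr 1; push_cast; ring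
    have f4 : ((-4 : ℝ)) ^ l = (-1) ^ l * 4 ^ l := by rw [← mul_pow]; norm_num
    have f5 : ((-1 : ℝ) ^ l)⁻¹ = (-1) ^ l :=
      inv_eq_of_mul_eq_one_left (by rw [← mul_pow]; simp)
    rw [f1, f2, f3, div_eq_mul_inv (Real.Gamma (α - l)), hG, f4, pow_add (-1 : ℝ) (2 * l),
      pow_mul]
    simp only [div_eq_mul_inv, mul_inv, f5, even_two, Even.neg_pow, one_pow, one_mul]
    ring
  have K0 : HasSum (fun l => P (2 * l + 1 + (n + 1))) 0 := by
    convert hasSum_zero with l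
    simp only [hP]
    rw [quot₁_add_even]
    simp
  -- The head j ≤ n restored here is the integral over the whole half-line, so a single series
  -- collects both contributions.
  have KP := (hasSum_nat_add_iff (n + 1)).1 (K1.even_add_odd (f := fun i => P (i + (n + 1))) K0)
  have K2 : HasSum (fun j : ℕ => (-1) ^ j / (j.factorial : ℝ) *
      (2 * coeff₂ α j n * y ^ (2 * (j : ℝ) + 1 + 2 * α) * y ^ n))
      ((√Real.pi)⁻¹ * (-1) ^ (n + 1) * I₂) := by
    refine (H2.mul_left ((√Real.pi)⁻¹ * (-1) ^ (n + 1))).congr_fun fun j => Eq.symm ?_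
    have hj : (0 : ℝ) ≤ j := Nat.cast_nonneg _
    have hn : (0 : ℝ) ≤ n := Nat.cast_nonneg _
    have hg := Gamma_neg_sub_nat_mul hα j
    have f3 : y ^ (2 * (j : ℝ) + 2 * α + n + 1) = y ^ (2 * (j : ℝ) + 1 + 2 * α) * y ^ n := by
      rw [← Real.rpow_natCast, ← Real.rpow_add_of_nonneg hy (by linarith) hn]
      congr 1; ring
    have f5 : ((-1 : ℝ) ^ j) * (-1) ^ j = 1 := by rw [← mul_pow]; simp
    rw [coeff₂_eq hα h, f3, show 2 * (j : ℝ) + n + 2 + 2 * α = 2 * j + 2 * α + n + 2 by ring]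
    calc _ = (√Real.pi)⁻¹ * (-1) ^ (n + 1) * ((-1) ^ j / j.factorial) *
          (y ^ (2 * (j : ℝ) + 1 + 2 * α) * y ^ n / Real.Gamma (2 * j + 2 * α + n + 2)) *
          ((1 / 4) ^ α * Real.Gamma (-α - j) / 4 ^ j * Real.Gamma (2 * j + 2 * α + 1)) := by
          field_simp
      _ = _ := by
        rw [hg, pow_add, pow_add]
        field_simp
  have hsum := KP.add K2
  have e1 : ∀ j : ℕ, P j + (-1) ^ j / (j.factorial : ℝ) *
      (2 * coeff₂ α j n * y ^ (2 * (j : ℝ) + 1 + 2 * α) * y ^ n) =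
      (-1) ^ j / (j.factorial : ℝ) * (quot₁ α j n * y ^ j +
      2 * coeff₂ α j n * y ^ (2 * (j : ℝ) + 1 + 2 * α) * y ^ n) := fun j => by
    simp only [hP]; ring
  have hInt := integrableOn_sub_pow_mul_besselInt h y n
  have hsub : Set.Ioc 0 y ⊆ Set.Ioi 0 := fun u hu => hu.1
  have hsplit := setIntegral_union (μ := volume) (Set.Ioc_disjoint_Ioi le_rfl)
    measurableSet_Ioi (hInt.mono_set hsub) (hInt.mono_set (Set.Ioi_subset_Ioi hy))
  rw [Set.Ioc_union_Ioi_eq_Ioi hy, integral_Ioi_zero_sub_pow_mul_besselInt h, hI] at hsplit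
  have hval : (√Real.pi)⁻¹ * ∫ x in Set.Ioi y,
      (x - y) ^ n / n.factorial * besselInt α (x ^ 2 / 4) =
      (√Real.pi)⁻¹ * (-1) ^ (n + 1) * I₁ + 0 + ∑ i ∈ Finset.range (n + 1), P i +
        (√Real.pi)⁻¹ * (-1) ^ (n + 1) * I₂ := by
    rw [← sub_eq_iff_eq_add'.2 hsplit, add_zero, pow_succ, mul_sub, ← mul_assoc (√Real.pi)⁻¹,
      inv_mul_cancel₀ hpi, one_mul]
    ring
  rw [hval]
  exact hsum.congr_fun fun j => (e1 j).symm

/-! ### Coefficient bounds and absolute convergence of the double series. -/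

/-- A sequence whose successive ratios tend to one grows slower than every geometric sequence. -/
theorem exists_abs_mul_pow_le {a c : ℕ → ℝ} (h : ∀ i, a (i + 1) = c i * a i)
    (hc : Tendsto c atTop (𝓝 1)) {r : ℝ} (hr0 : 0 < r) (hr1 : r < 1) :
    ∃ C, ∀ i, |a i| * r ^ i ≤ C := by
  have hev : ∀ᶠ i in atTop, |c i| * r < 1 := by
    have : Tendsto (fun i => |c i| * r) atTop (𝓝 (|1| * r)) := hc.abs.mul_const r
    exact this.eventually_lt_const (by simpa using hr1)
  obtain ⟨N, hN⟩ := eventually_atTop.1 hev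
  have hb : ∀ i, 0 ≤ |a i| * r ^ i := fun i => by positivity
  have key : ∀ k, |a (N + k)| * r ^ (N + k) ≤ |a N| * r ^ N := by
    intro k
    induction k with
    | zero => simp
    | succ k ih =>
      refine le_trans ?_ ih
      rw [← add_assoc, h, abs_mul, pow_succ]
      calc |c (N + k)| * |a (N + k)| * (r ^ (N + k) * r)
          = (|c (N + k)| * r) * (|a (N + k)| * r ^ (N + k)) := by ring
        _ ≤ 1 * (|a (N + k)| * r ^ (N + k)) :=
          mul_le_mul_of_nonneg_right (hN _ (by omega)).le (hb _)
        _ = _ := one_mul _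
  refine ⟨∑ i ∈ Finset.range (N + 1), |a i| * r ^ i, fun i => ?_⟩
  rcases le_total i N with hi | hi
  · exact Finset.single_le_sum (f := fun i => |a i| * r ^ i) (fun i _ => hb i)
      (Finset.mem_range.2 (by omega))
  · obtain ⟨k, rfl⟩ := Nat.exists_eq_add_of_le hi
    exact (key k).trans (Finset.single_le_sum (f := fun i => |a i| * r ^ i) (fun i _ => hb i)
      (Finset.mem_range.2 (by omega)))

theorem tendsto_natCast_add_div_add (p q : ℝ) :
    Tendsto (fun i : ℕ => ((i : ℝ) + p) / (i + q)) atTop (𝓝 1) := by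
  have := tendsto_add_mul_div_add_mul_atTop_nhds p q (1 : ℝ) (d := 1) one_ne_zero
  simpa [add_comm] using this

/-- The quotient depends only on n - j, so it runs through `A` on or above the diagonal and through
`B` or 0 below it. The even and odd parts of `A`, and `B`, have successive ratios tending to 1; each
of their steps moves n - j by two, hence the rate r². -/
theorem exists_abs_quot₁_le {α : ℝ} (hα : ∀ m : ℤ, α ≠ m) (h : -(1 / 2) < α) {r : ℝ}
    (hr0 : 0 < r) (hr1 : r < 1) : ∃ C, ∀ j n, |quot₁ α j n| * r ^ (j + n) ≤ C := by
  set A : ℕ → ℝ := fun m => Real.Gamma (((m : ℝ) + 1) / 2 + α) / Real.Gamma ((m : ℝ) / 2 + 1)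
    with hA
  set B : ℕ → ℝ := fun l => Real.Gamma (α - l) / Real.Gamma (1 / 2 - l) with hB
  have hA2 : ∀ m, A (m + 2) = (((m : ℝ) + 1) / 2 + α) / ((m : ℝ) / 2 + 1) * A m := by
    intro m
    have hm : (0 : ℝ) ≤ m := Nat.cast_nonneg _
    simp only [hA]
    have e1 : (((m + 2 : ℕ) : ℝ) + 1) / 2 + α = (((m : ℝ) + 1) / 2 + α) + 1 := by push_cast; ring
    have e2 : ((m + 2 : ℕ) : ℝ) / 2 + 1 = ((m : ℝ) / 2 + 1) + 1 := by push_cast; ring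
    rw [e1, e2, Real.Gamma_add_one (by linarith), Real.Gamma_add_one (by positivity)]
    field_simp
  have hB1 : ∀ l, B (l + 1) = ((l : ℝ) + 1 / 2) / (l + (1 - α)) * B l := by
    intro l
    have h12 : ∀ m : ℤ, (1 / 2 : ℝ) ≠ m := by
      intro m hm
      have : (1 : ℝ) = ((2 * m : ℤ) : ℝ) := by push_cast; linarith
      have : (1 : ℤ) = 2 * m := by exact_mod_cast this
      omega
    have g1 := Gamma_sub_nat_succ hα l
    have g2 := Gamma_sub_nat_succ h12 l
    have n1 := Gamma_sub_nat_ne_zero h12 (l + 1)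
    have n2 : (l : ℝ) + (1 - α) ≠ 0 := fun h => hα (l + 1) (by push_cast; linarith)
    have n3 : (1 / 2 : ℝ) - l - 1 ≠ 0 := fun h => by
      have hm : (0 : ℝ) ≤ l := Nat.cast_nonneg _
      linarith
    simp only [hB]
    rw [g1, g2, div_mul_div_comm, div_eq_div_iff n1 (mul_ne_zero n2 (mul_ne_zero n3 n1))]
    ring
  have hr2 : r ^ 2 < 1 := pow_lt_one₀ hr0.le hr1 two_ne_zero
  obtain ⟨C0, hC0⟩ := exists_abs_mul_pow_le (a := fun i => A (2 * i))
    (c := fun i : ℕ => ((i : ℝ) + (1 / 2 + α)) / (i + 1)) (fun i => by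
      rw [show 2 * (i + 1) = 2 * i + 2 by ring, hA2]
      congr 2 <;> push_cast <;> ring) (tendsto_natCast_add_div_add _ _) (pow_pos hr0 2) hr2
  obtain ⟨C1, hC1⟩ := exists_abs_mul_pow_le (a := fun i => A (2 * i + 1))
    (c := fun i : ℕ => ((i : ℝ) + (1 + α)) / (i + 3 / 2)) (fun i => by
      rw [show 2 * (i + 1) + 1 = 2 * i + 1 + 2 by ring, hA2]
      congr 2 <;> push_cast <;> ring) (tendsto_natCast_add_div_add _ _) (pow_pos hr0 2) hr2
  obtain ⟨C2, hC2⟩ := exists_abs_mul_pow_le (a := B) hB1 (tendsto_natCast_add_div_add _ _)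
    (pow_pos hr0 2) hr2
  have hC0' : 0 ≤ C0 := le_trans (by positivity) (hC0 0)
  have hC1' : 0 ≤ C1 := le_trans (by positivity) (hC1 0)
  have hC2' : 0 ≤ C2 := le_trans (by positivity) (hC2 0)
  refine ⟨C0 + C1 + C2, fun j n => ?_⟩
  have hpow : ∀ {k l : ℕ}, k ≤ l → r ^ l ≤ r ^ k := fun h => pow_le_pow_of_le_one hr0.le hr1.le h
  rcases le_or_gt j n with hjn | hjn
  · have e : quot₁ α j n = A (n - j) := quot₁_sub α hjn
    rw [e]
    rcases Nat.even_or_odd' (n - j) with ⟨i, hi | hi⟩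
    · rw [hi]
      calc |A (2 * i)| * r ^ (j + n) ≤ |A (2 * i)| * r ^ (2 * i) := by
            gcongr ?_ * ?_; exact hpow (by omega)
        _ ≤ C0 := by rw [pow_mul]; exact hC0 i
        _ ≤ _ := by linarith
    · rw [hi]
      calc |A (2 * i + 1)| * r ^ (j + n) ≤ |A (2 * i + 1)| * r ^ (2 * i) := by
            gcongr ?_ * ?_; exact hpow (by omega)
        _ ≤ C1 := by rw [pow_mul]; exact hC1 i
        _ ≤ _ := by linarith
  · obtain ⟨k, rfl⟩ : ∃ k, j = k + (n + 1) := ⟨j - (n + 1), by omega⟩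
    rcases Nat.even_or_odd' k with ⟨l, hl | hl⟩
    · rw [hl, quot₁_add_odd]
      calc |B l| * r ^ (2 * l + (n + 1) + n) ≤ |B l| * r ^ (2 * l) := by
            gcongr ?_ * ?_; exact hpow (by omega)
        _ ≤ C2 := by rw [pow_mul]; exact hC2 l
        _ ≤ _ := by linarith
    · rw [hl, quot₁_add_even]
      simp only [abs_zero, zero_mul]
      linarith

/-- Raising j multiplies the quotient at n = 0 by a factor at most 1, and raising n divides it by 2j
+ n + 1 + 2q ≥ n + 1. -/
theorem Gamma_div_Gamma_two_mul_add_le {q : ℝ} (hq : 0 < q) (j n : ℕ) :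
    Real.Gamma (j + q) / Real.Gamma (2 * j + n + 1 + 2 * q) ≤
      (Real.Gamma q / Real.Gamma (1 + 2 * q)) / n.factorial := by
  induction n with
  | zero =>
    simp only [Nat.factorial_zero, Nat.cast_one, div_one, CharP.cast_eq_zero, add_zero]
    induction j with
    | zero => simp
    | succ j ih =>
      have hj : (0 : ℝ) ≤ j := Nat.cast_nonneg _
      refine le_trans ?_ ih
      have e1 : ((j + 1 : ℕ) : ℝ) + q = (j + q) + 1 := by push_cast; ring
      have e2 : 2 * ((j + 1 : ℕ) : ℝ) + 1 + 2 * q = (2 * j + 1 + 2 * q) + 1 + 1 := by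
        push_cast; ring
      have g1 : 0 < Real.Gamma (j + q) := Real.Gamma_pos_of_pos (by positivity)
      have g2 : 0 < Real.Gamma (2 * j + 1 + 2 * q) := Real.Gamma_pos_of_pos (by positivity)
      rw [e1, e2, Real.Gamma_add_one (by positivity), Real.Gamma_add_one (by positivity),
        Real.Gamma_add_one (by positivity), ← mul_assoc, mul_div_mul_comm]
      refine mul_le_of_le_one_left (by positivity) ?_
      rw [div_le_one (by positivity)]
      nlinarith
  | succ n ih =>
    have hj : (0 : ℝ) ≤ j := Nat.cast_nonneg _
    have hn : (0 : ℝ) ≤ n := Nat.cast_nonneg _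
    have g1 : 0 < Real.Gamma (j + q) := Real.Gamma_pos_of_pos (by positivity)
    have g2 : 0 < Real.Gamma (2 * j + n + 1 + 2 * q) := Real.Gamma_pos_of_pos (by positivity)
    have e2 : 2 * (j : ℝ) + (n + 1 : ℕ) + 1 + 2 * q = (2 * j + n + 1 + 2 * q) + 1 := by
      push_cast; ring
    rw [e2, Real.Gamma_add_one (by positivity), mul_comm, ← div_div, Nat.factorial_succ,
      mul_comm (n + 1), Nat.cast_mul, ← div_div]
    gcongr
    push_cast
    linarith

theorem exists_abs_coeff₂_le {α : ℝ} (hα : ∀ m : ℤ, α ≠ m) (h : -(1 / 2) < α) :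
    ∃ C, ∀ j n, |coeff₂ α j n| ≤ C / n.factorial := by
  refine ⟨|2 * Real.sin (Real.pi * α)|⁻¹ *
    (Real.Gamma (α + 1 / 2) / Real.Gamma (1 + 2 * (α + 1 / 2))), fun j n => ?_⟩
  have hq : 0 < α + 1 / 2 := by linarith
  have hb := Gamma_div_Gamma_two_mul_add_le hq j n
  have g1 : 0 < Real.Gamma (j + (α + 1 / 2)) := Real.Gamma_pos_of_pos (by positivity)
  have g2 : 0 < Real.Gamma (2 * j + n + 1 + 2 * (α + 1 / 2)) :=
    Real.Gamma_pos_of_pos (by positivity)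
  rw [coeff₂_eq hα h, show (j : ℝ) + 1 / 2 + α = j + (α + 1 / 2) by ring,
    show 2 * (j : ℝ) + n + 2 + 2 * α = 2 * j + n + 1 + 2 * (α + 1 / 2) by ring, abs_div, abs_mul,
    abs_mul _ (Real.Gamma _), abs_pow, abs_neg, abs_one, one_pow, one_mul, abs_of_pos g1,
    abs_of_pos g2, mul_div_assoc, ← inv_mul_eq_div (|_| * _), mul_inv, mul_assoc,
    inv_mul_eq_div (Real.Gamma _)]
  gcongr

/-- Parametrising by k = -(y s) gives -k / s = y for either sign of s, so the two moneyness cases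
share one computation. -/
theorem otmTerm_eq {α y s : ℝ} (hs : s ≠ 0) (j n : ℕ) : otmTerm α (-(y * s)) s j n =
    s ^ n * ((-1) ^ j / (j.factorial : ℝ) * (quot₁ α j n * y ^ j +
      2 * coeff₂ α j n * y ^ (2 * (j : ℝ) + 1 + 2 * α) * y ^ n)) := by
  rw [otmTerm, neg_neg, mul_div_cancel_right₀ _ hs, mul_pow]
  ring

/-- With |s| < r < 1, the growth r^(-(j+n)) of `quot₁` is absorbed by 1 / j! in j and by the
geometric ratio |s| / r in n. The `coeff₂` part is dominated by a product of exponential series. -/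
theorem summable_otmTerm {α y s : ℝ} (hα : ∀ m : ℤ, α ≠ m) (h : -(1 / 2) < α) (hy : 0 ≤ y)
    (hs0 : s ≠ 0) (hs1 : |s| < 1) :
    Summable fun p : ℕ × ℕ => otmTerm α (-(y * s)) s p.1 (p.2 + 1) := by
  obtain ⟨r, hr, hr1⟩ := exists_between hs1
  have hr0 : 0 < r := (abs_nonneg s).trans_lt hr
  obtain ⟨C, hC⟩ := exists_abs_quot₁_le hα h hr0 hr1
  obtain ⟨D, hD⟩ := exists_abs_coeff₂_le hα h
  have S1 : Summable fun p : ℕ × ℕ => (C * ((y / r) ^ p.1 / p.1.factorial)) *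
      (|s| / r) ^ (p.2 + 1) := by
    refine Summable.mul_of_nonneg (f := fun j : ℕ => C * ((y / r) ^ j / j.factorial))
      (g := fun n : ℕ => (|s| / r) ^ (n + 1))
      ((Real.summable_pow_div_factorial _).mul_left C) ?_ ?_ ?_
    · exact (summable_nat_add_iff 1).2
        (summable_geometric_of_lt_one (by positivity) ((div_lt_one hr0).2 hr))
    · intro j
      have : 0 ≤ C := le_trans (by positivity) (hC 0 0)
      simp only [Pi.zero_apply]
      positivity
    · intro n
      simp only [Pi.zero_apply]
      positivity
  have S2 : Summable fun p : ℕ × ℕ => (2 * D * y ^ (1 + 2 * α) * ((y ^ 2) ^ p.1 / p.1.factorial)) *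
      ((|s| * y) ^ (p.2 + 1) / (p.2 + 1).factorial) := by
    refine Summable.mul_of_nonneg
      (f := fun j : ℕ => 2 * D * y ^ (1 + 2 * α) * ((y ^ 2) ^ j / j.factorial))
      (g := fun n : ℕ => (|s| * y) ^ (n + 1) / (n + 1).factorial)
      ((Real.summable_pow_div_factorial _).mul_left _)
      ((summable_nat_add_iff 1).2 (Real.summable_pow_div_factorial (|s| * y))) ?_ ?_
    · intro j
      have : 0 ≤ D := by
        have := hD 0 0
        simp only [Nat.factorial_zero, Nat.cast_one, div_one] at this
        exact (abs_nonneg _).trans this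
      simp only [Pi.zero_apply]
      positivity
    · intro n
      simp only [Pi.zero_apply]
      positivity
  refine Summable.of_norm_bounded (S1.add S2) fun p => ?_
  obtain ⟨j, n⟩ := p
  simp only
  have e0 : y ^ (2 * (j : ℝ) + 1 + 2 * α) = (y ^ 2) ^ j * y ^ (1 + 2 * α) := by
    have hj : (0 : ℝ) ≤ j := Nat.cast_nonneg _
    rw [← pow_mul, ← Real.rpow_natCast, ← Real.rpow_add_of_nonneg hy (by positivity) (by linarith)]
    congr 1; push_cast; ring
  rw [otmTerm_eq hs0, norm_mul, norm_mul, norm_div, norm_pow, norm_pow, norm_neg, norm_one, one_pow,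
    Real.norm_eq_abs s, Real.norm_of_nonneg (by positivity : (0 : ℝ) ≤ j.factorial), e0]
  have b1 : |quot₁ α j (n + 1)| ≤ C / r ^ (j + (n + 1)) := by
    rw [le_div_iff₀ (by positivity)]; exact hC _ _
  calc |s| ^ (n + 1) * (1 / (j.factorial : ℝ) * ‖quot₁ α j (n + 1) * y ^ j +
        2 * coeff₂ α j (n + 1) * ((y ^ 2) ^ j * y ^ (1 + 2 * α)) * y ^ (n + 1)‖)
      ≤ |s| ^ (n + 1) * (1 / (j.factorial : ℝ) * (|quot₁ α j (n + 1)| * y ^ j +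
        2 * |coeff₂ α j (n + 1)| * ((y ^ 2) ^ j * y ^ (1 + 2 * α)) * y ^ (n + 1))) := by
        gcongr
        refine (norm_add_le _ _).trans (le_of_eq ?_)
        simp only [norm_mul, Real.norm_eq_abs]
        rw [abs_of_nonneg (by positivity : 0 ≤ y ^ j), abs_of_nonneg (by norm_num : (0 : ℝ) ≤ 2),
          abs_of_nonneg (by positivity : 0 ≤ (y ^ 2) ^ j),
          abs_of_nonneg (by positivity : 0 ≤ y ^ (1 + 2 * α)),
          abs_of_nonneg (by positivity : 0 ≤ y ^ (n + 1))]
    _ ≤ |s| ^ (n + 1) * (1 / (j.factorial : ℝ) * (C / r ^ (j + (n + 1)) * y ^ j +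
        2 * (D / (n + 1).factorial) * ((y ^ 2) ^ j * y ^ (1 + 2 * α)) * y ^ (n + 1))) := by
        gcongr
        exact hD _ _
    _ = _ := by
        rw [div_pow, div_pow, mul_pow, pow_add r]
        have := Nat.factorial_ne_zero
        field_simp

/-- The double series of the call is the truncated exponential moment of the Bessel density. -/
theorem hasSum_otmTerm {α y s : ℝ} (hα : ∀ m : ℤ, α ≠ m) (h : -(1 / 2) < α) (hy : 0 ≤ y)
    (hs0 : s ≠ 0) (hs1 : |s| < 1) :
    HasSum (fun p : ℕ × ℕ => otmTerm α (-(y * s)) s p.1 (p.2 + 1))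
      ((√Real.pi)⁻¹ * ∫ x in Set.Ioi y,
        (Real.exp (s * (x - y)) - 1) * besselInt α (x ^ 2 / 4)) := by
  have hsm := summable_otmTerm hα h hy hs0 hs1
  have hpi : √Real.pi ≠ 0 := by positivity
  set g : ℕ → ℝ := fun n => ∫ x in Set.Ioi y,
    (x - y) ^ n / n.factorial * besselInt α (x ^ 2 / 4) with hg
  have hg0 : ∀ n, 0 ≤ g n := fun n => setIntegral_nonneg measurableSet_Ioi fun x hx => by
    have := besselInt_nonneg α (x ^ 2 / 4)
    have : 0 ≤ x - y := sub_nonneg.2 (le_of_lt hx)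
    positivity
  have hfib : ∀ n : ℕ, HasSum (fun j => otmTerm α (-(y * s)) s j (n + 1))
      (s ^ (n + 1) * ((√Real.pi)⁻¹ * g (n + 1))) := by
    intro n
    simp_rw [otmTerm_eq hs0]
    exact (hasSum_integral_Ioi_sub_pow_mul_besselInt hα h hy (n + 1)).mul_left _
  -- Absolute convergence permits summing over j first, which produces the truncated moments.
  have hswap := (Equiv.prodComm ℕ ℕ).hasSum_iff.2 hsm.hasSum
  have hG := HasSum.prod_fiberwise hswap fun n => hfib n
  set F : ℕ → ℝ → ℝ := fun n x => s ^ (n + 1) * ((x - y) ^ (n + 1) / (n + 1).factorial *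
    besselInt α (x ^ 2 / 4)) with hF
  have hFi : ∀ n, Integrable (F n) (volume.restrict (Set.Ioi y)) := fun n =>
    ((integrableOn_sub_pow_mul_besselInt h y (n + 1)).mono_set
      (Set.Ioi_subset_Ioi hy)).const_mul _
  have hFn : ∀ n, ∫ x in Set.Ioi y, ‖F n x‖ = |s| ^ (n + 1) * g (n + 1) := by
    intro n
    rw [hg, ← integral_const_mul]
    refine setIntegral_congr_fun measurableSet_Ioi fun x hx => ?_
    have := besselInt_nonneg α (x ^ 2 / 4)
    have : 0 ≤ x - y := sub_nonneg.2 (le_of_lt hx)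
    simp only [hF]
    rw [norm_mul, norm_pow, Real.norm_eq_abs, Real.norm_of_nonneg (by positivity)]
  -- The truncated moments are nonnegative, so these norms are, up to √π, the absolute values of the
  -- fibre sums, already known to be summable.
  have hFs : Summable fun n => ∫ x in Set.Ioi y, ‖F n x‖ := by
    refine (hG.summable.norm.mul_left √Real.pi).congr fun n => ?_
    rw [hFn, norm_mul, norm_pow, Real.norm_eq_abs,
      Real.norm_of_nonneg (mul_nonneg (by positivity) (hg0 _))]
    field_simp
  have key := (hasSum_integral_of_summable_integral_norm hFi hFs).mul_left (√Real.pi)⁻¹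
  have e1 : ∫ x in Set.Ioi y, ∑' n, F n x = ∫ x in Set.Ioi y,
      (Real.exp (s * (x - y)) - 1) * besselInt α (x ^ 2 / 4) := by
    refine setIntegral_congr_fun measurableSet_Ioi fun x _ => ?_
    have he : HasSum (fun n : ℕ => (s * (x - y)) ^ n / n.factorial) (Real.exp (s * (x - y))) := by
      rw [Real.exp_eq_exp_ℝ]
      exact NormedSpace.expSeries_div_hasSum_exp _
    -- The sum starts at n₂ = 1, which is why the exponential appears minus 1.
    have he1 := (hasSum_nat_add_iff' 1).2 he
    simp only [Finset.range_one, Finset.sum_singleton, pow_zero, Nat.factorial_zero, Nat.cast_one,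
      div_one] at he1
    simp only [hF]
    rw [← (he1.mul_right (besselInt α (x ^ 2 / 4))).tsum_eq]
    exact tsum_congr fun n => by rw [mul_pow]; ring
  rw [e1] at key
  have huniq := hG.unique (key.congr_fun fun n => by
    simp only [hF]
    rw [integral_const_mul]
    ring)
  rw [← huniq]
  exact hsm.hasSum

/-! ### The Variance Gamma law: Bessel density and exponential moment. -/

/-- The density at time `(α + 1 / 2) ν` of the symmetric process with unit rescaled volatility. -/
noncomputable def symmDensity (α x : ℝ) : ℝ :=
  (2 * √Real.pi * Real.Gamma (α + 1 / 2))⁻¹ * besselInt α (x ^ 2 / 4)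

theorem measurable_symmDensity (α : ℝ) : Measurable (symmDensity α) :=
  ((measurable_besselInt α).comp (by fun_prop)).const_mul _

theorem symmDensity_nonneg {α : ℝ} (h : -(1 / 2) < α) (x : ℝ) : 0 ≤ symmDensity α x := by
  have := besselInt_nonneg α (x ^ 2 / 4)
  have := Real.Gamma_pos_of_pos (by linarith : 0 < α + 1 / 2)
  rw [symmDensity]
  positivity

theorem symmDensity_neg (α x : ℝ) : symmDensity α (-x) = symmDensity α x := by
  simp [symmDensity]

theorem gammaPDF_mul_gaussianPDF {α ν t : ℝ} (hν : 0 < ν) (h : -(1 / 2) < α) (ht : 0 < t)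
    (x : ℝ) :
    gammaPDF (α + 1 / 2) (1 / ν) t * gaussianPDF 0 (2 * t / ν).toNNReal x =
      ENNReal.ofReal ((2 * √Real.pi * Real.Gamma (α + 1 / 2))⁻¹ * ν⁻¹ *
        ((ν⁻¹ * t) ^ (α - 1) * Real.exp (-(ν⁻¹ * t) - (x ^ 2 / 4) / (ν⁻¹ * t)))) := by
  have hΓ := Real.Gamma_pos_of_pos (by linarith : 0 < α + 1 / 2)
  have hu : 0 < ν⁻¹ * t := by positivity
  rw [gammaPDF_of_nonneg ht.le, gaussianPDF, ← ENNReal.ofReal_mul (by positivity),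
    gaussianPDFReal, Real.coe_toNNReal _ (by positivity)]
  congr 1
  have e1 : (1 / ν) ^ (α + 1 / 2) * t ^ (α + 1 / 2 - 1) =
      ν⁻¹ * ((ν⁻¹ * t) ^ (α - 1) * √(ν⁻¹ * t)) := by
    have e0 : (1 / ν) ^ (α + 1 / 2) = ν⁻¹ * ν⁻¹ ^ (α + 1 / 2 - 1) := by
      rw [one_div, Real.rpow_sub_one (by positivity : ν⁻¹ ≠ 0)]
      field_simp
    rw [Real.sqrt_eq_rpow, ← Real.rpow_add hu, show α - 1 + 1 / 2 = α + 1 / 2 - 1 by ring,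
      Real.mul_rpow (by positivity) ht.le, e0, mul_assoc]
  have e2 : √(2 * Real.pi * (2 * t / ν)) = 2 * √Real.pi * √(ν⁻¹ * t) := by
    rw [show 2 * Real.pi * (2 * t / ν) = 2 ^ 2 * (Real.pi * (ν⁻¹ * t)) by field_simp,
      Real.sqrt_mul (by positivity), Real.sqrt_sq (by norm_num), Real.sqrt_mul Real.pi_pos.le]
    ring
  have e3 : Real.exp (-(ν⁻¹ * t) - (x ^ 2 / 4) / (ν⁻¹ * t)) =
      Real.exp (-(1 / ν * t)) * Real.exp (-(x - 0) ^ 2 / (2 * (2 * t / ν))) := by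
    rw [← Real.exp_add]
    congr 1
    field_simp
    ring
  have hs : √(ν⁻¹ * t) ≠ 0 := by positivity
  have hpi : √Real.pi ≠ 0 := by positivity
  rw [e2, e3]
  calc _ = ((1 / ν) ^ (α + 1 / 2) * t ^ (α + 1 / 2 - 1)) * (Real.Gamma (α + 1 / 2))⁻¹ *
        (Real.exp (-(1 / ν * t)) * Real.exp (-(x - 0) ^ 2 / (2 * (2 * t / ν)))) *
        (2 * √Real.pi * √(ν⁻¹ * t))⁻¹ := by ring
    _ = _ := by
      rw [e1]
      field_simp

theorem lintegral_gammaPDF_mul_gaussianPDF {α ν x : ℝ} (hν : 0 < ν) (h : -(1 / 2) < α)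
    (hx : x ≠ 0) :
    ∫⁻ t in Set.Ioi 0, gammaPDF (α + 1 / 2) (1 / ν) t * gaussianPDF 0 (2 * t / ν).toNNReal x =
      ENNReal.ofReal (symmDensity α x) := by
  have hΓ := Real.Gamma_pos_of_pos (by linarith : 0 < α + 1 / 2)
  have hν' : 0 < ν⁻¹ := inv_pos.2 hν
  have hz : 0 < x ^ 2 / 4 := by positivity
  rw [setLIntegral_congr_fun measurableSet_Ioi
    fun t (ht : 0 < t) => gammaPDF_mul_gaussianPDF hν h ht x]
  have hi : IntegrableOn (fun t => (ν⁻¹ * t) ^ (α - 1) *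
      Real.exp (-(ν⁻¹ * t) - (x ^ 2 / 4) / (ν⁻¹ * t))) (Set.Ioi 0) := by
    refine (integrableOn_Ioi_comp_mul_left_iff
      (fun t => t ^ (α - 1) * Real.exp (-t - (x ^ 2 / 4) / t)) 0 hν').2 ?_
    rw [mul_zero]
    exact integrableOn_besselInt hz
  rw [← ofReal_integral_eq_lintegral_ofReal (hi.const_mul _), integral_const_mul,
    integral_comp_mul_left_Ioi (fun t => t ^ (α - 1) * Real.exp (-t - (x ^ 2 / 4) / t)) 0 hν',
    mul_zero]
  · congr 1
    rw [symmDensity, besselInt, smul_eq_mul, inv_inv, mul_assoc (_)⁻¹,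
      inv_mul_cancel_left₀ hν.ne']
  · refine (ae_restrict_iff' measurableSet_Ioi).2 (ae_of_all _ fun t (ht : 0 < t) => ?_)
    simp only [Pi.zero_apply]
    positivity

theorem lintegral_law {σ ν t : ℝ} {φ : ℝ → ENNReal} (hφ : Measurable φ) :
    ∫⁻ x, φ x ∂law σ ν 0 t = ∫⁻ u in Set.Ioi 0, gammaPDF (t / ν) (1 / ν) u *
      ∫⁻ z, φ (σ * √u * z) ∂gaussianReal 0 1 := by
  have hm : Measurable (gammaPDF (t / ν) (1 / ν)) := by
    unfold gammaPDF; fun_prop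
  have hin : Measurable fun u : ℝ => ∫⁻ z, φ (σ * √u * z) ∂gaussianReal 0 1 :=
    Measurable.lintegral_prod_right' (f := fun p : ℝ × ℝ => φ (σ * √p.1 * p.2))
      (hφ.comp (by fun_prop))
  have hφ2 : Measurable fun p : ℝ × ℝ => φ (0 * p.1 + σ * √p.1 * p.2) := hφ.comp (by fun_prop)
  rw [law, lintegral_map hφ (by fun_prop), gammaMeasure, lintegral_prod _ hφ2.aemeasurable]
  simp only [zero_mul, zero_add]
  rw [lintegral_withDensity_eq_lintegral_mul _ hm hin]
  simp only [Pi.mul_apply]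
  have h0 : ∫⁻ u in Set.Iio 0, gammaPDF (t / ν) (1 / ν) u *
      ∫⁻ z, φ (σ * √u * z) ∂gaussianReal 0 1 = 0 := by
    rw [setLIntegral_congr_fun measurableSet_Iio (g := fun _ => 0)
      (fun u (hu : u < 0) => by simp only [gammaPDF_of_neg hu, zero_mul]), lintegral_zero]
  rw [← lintegral_add_compl _ (measurableSet_Iio (a := (0 : ℝ))), h0, zero_add, Set.compl_Iio,
    setLIntegral_congr Ioi_ae_eq_Ici]

/-- Since σ √t = s √(2t / ν), extracting s leaves a Gaussian of variance 2t / ν, whose exponent x² ν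
/ (4t) matches the Bessel integral in the variable t / ν. -/
theorem lintegral_gaussianReal_one_comp {ν s σ t : ℝ} (hν : 0 < ν) (hs : s = σ * √(ν / 2))
    (ht : 0 < t) {φ : ℝ → ENNReal} (hφ : Measurable φ) :
    ∫⁻ z, φ (σ * √t * z) ∂gaussianReal 0 1 =
      ∫⁻ x, gaussianPDF 0 (2 * t / ν).toNNReal x * φ (s * x) := by
  have hv : (2 * t / ν).toNNReal ≠ 0 := (Real.toNNReal_pos.2 (by positivity)).ne'
  have hmap := gaussianReal_map_const_mul (μ := 0) (v := 1) (√(2 * t / ν))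
  have hvar : NNReal.mk (√(2 * t / ν) ^ 2) (sq_nonneg _) * 1 = (2 * t / ν).toNNReal := by
    ext
    rw [Real.coe_toNNReal _ (by positivity)]
    simp [Real.sq_sqrt (by positivity : 0 ≤ 2 * t / ν)]
  rw [mul_zero, hvar] at hmap
  have hsc : s * √(2 * t / ν) = σ * √t := by
    rw [hs, mul_assoc, ← Real.sqrt_mul (by positivity)]
    congr 2
    field_simp
  have hφs : Measurable fun x => φ (s * x) := hφ.comp (by fun_prop)
  calc _ = ∫⁻ z, φ (s * (√(2 * t / ν) * z)) ∂gaussianReal 0 1 := by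
        simp_rw [← mul_assoc, hsc]
    _ = ∫⁻ x, φ (s * x) ∂gaussianReal 0 (2 * t / ν).toNNReal := by
        rw [← hmap, lintegral_map hφs (by fun_prop)]
    _ = _ := by
        rw [gaussianReal_of_var_ne_zero _ hv,
          lintegral_withDensity_eq_lintegral_mul _ (measurable_gaussianPDF _ _) hφs]
        rfl

/-- The symmetric Variance Gamma law has a Bessel density. -/
theorem law_eq_map_withDensity {σ ν τ α s : ℝ} (hν : 0 < ν) (hτ : 0 < τ) (hα : α = τ / ν - 1 / 2)
    (hs : s = σ * √(ν / 2)) :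
    law σ ν 0 τ =
      (volume.withDensity fun x => ENNReal.ofReal (symmDensity α x)).map (fun x => s * x) := by
  have h : -(1 / 2) < α := by
    have : 0 < τ / ν := by positivity
    linarith
  have hq : τ / ν = α + 1 / 2 := by linarith
  refine Measure.ext_of_lintegral _ fun φ hφ => ?_
  have hφs : Measurable fun x => φ (s * x) := hφ.comp (by fun_prop)
  have hden : Measurable fun x => ENNReal.ofReal (symmDensity α x) :=
    (measurable_symmDensity α).ennreal_ofReal
  rw [lintegral_law hφ, lintegral_map hφ (by fun_prop),
    lintegral_withDensity_eq_lintegral_mul _ hden hφs]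
  have hkm : Measurable fun p : ℝ × ℝ => gammaPDF (α + 1 / 2) (1 / ν) p.1 *
      (gaussianPDF 0 (2 * p.1 / ν).toNNReal p.2 * φ (s * p.2)) := by
    refine Measurable.mul ?_ (Measurable.mul ?_ (hφs.comp measurable_snd))
    · unfold gammaPDF; fun_prop
    · unfold gaussianPDF gaussianPDFReal; fun_prop
  calc _ = ∫⁻ t in Set.Ioi 0, ∫⁻ x, gammaPDF (α + 1 / 2) (1 / ν) t *
        (gaussianPDF 0 (2 * t / ν).toNNReal x * φ (s * x)) := by
        refine setLIntegral_congr_fun measurableSet_Ioi fun t (ht : 0 < t) => ?_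
        have hm : Measurable fun x => gaussianPDF 0 (2 * t / ν).toNNReal x * φ (s * x) :=
          (measurable_gaussianPDF _ _).mul hφs
        rw [lintegral_const_mul _ hm, lintegral_gaussianReal_one_comp hν hs ht hφ, hq]
    _ = ∫⁻ x, ∫⁻ t in Set.Ioi 0, gammaPDF (α + 1 / 2) (1 / ν) t *
        (gaussianPDF 0 (2 * t / ν).toNNReal x * φ (s * x)) :=
        lintegral_lintegral_swap hkm.aemeasurable
    _ = _ := by
        refine lintegral_congr_ae ?_
        -- At x = 0 the integral over t may diverge when α ≤ 0; the point is negligible.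
        have : ∀ᵐ x : ℝ, x ≠ 0 := by
          simp [ae_iff]
        filter_upwards [this] with x hx
        have hm : Measurable fun t => gammaPDF (α + 1 / 2) (1 / ν) t *
            gaussianPDF 0 (2 * t / ν).toNNReal x := by
          unfold gammaPDF gaussianPDF gaussianPDFReal; fun_prop
        simp only [Pi.mul_apply]
        rw [← lintegral_gammaPDF_mul_gaussianPDF hν h hx, ← lintegral_mul_const _ hm]
        exact lintegral_congr fun t => by rw [mul_assoc]

theorem isProbabilityMeasure_law {σ ν τ : ℝ} (hν : 0 < ν) (hτ : 0 < τ) :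
    IsProbabilityMeasure (law σ ν 0 τ) := by
  have := isProbabilityMeasure_gammaMeasure (a := τ / ν) (r := 1 / ν) (by positivity)
    (by positivity)
  exact Measure.isProbabilityMeasure_map (by fun_prop)

theorem integral_law {σ ν τ α s : ℝ} (hν : 0 < ν) (hτ : 0 < τ) (hα : α = τ / ν - 1 / 2)
    (hs : s = σ * √(ν / 2)) {φ : ℝ → ℝ} (hφ : Measurable φ) :
    ∫ x, φ x ∂law σ ν 0 τ = ∫ x, symmDensity α x * φ (s * x) := by
  have h : -(1 / 2) < α := by
    have : 0 < τ / ν := by positivity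
    linarith
  rw [law_eq_map_withDensity hν hτ hα hs, integral_map (by fun_prop) hφ.aestronglyMeasurable,
    integral_withDensity_eq_integral_toReal_smul (measurable_symmDensity α).ennreal_ofReal
      (ae_of_all _ fun x => ENNReal.ofReal_lt_top)]
  refine integral_congr_ae (ae_of_all _ fun x => ?_)
  simp only [smul_eq_mul]
  rw [ENNReal.toReal_ofReal (symmDensity_nonneg h x)]

/-- The Gaussian average gives e^(σ² u / 2), which tilts the Gamma density to the rate 1/ν - σ²/2,
positive exactly because σ² ν < 2. The value is the ratio of normalising constants. -/
theorem lintegral_exp_law {σ ν τ : ℝ} (hν : 0 < ν) (hτ : 0 < τ) (hσν : σ ^ 2 * ν < 2) :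
    ∫⁻ x, ENNReal.ofReal (Real.exp x) ∂law σ ν 0 τ =
      ENNReal.ofReal ((1 - σ ^ 2 * ν / 2) ^ (-(τ / ν))) := by
  have hq : 0 < τ / ν := by positivity
  have hb : 0 < 1 / ν - σ ^ 2 / 2 := by
    rw [sub_pos, div_lt_div_iff₀ two_pos hν]; linarith
  have hb' : 0 < 1 - σ ^ 2 * ν / 2 := by linarith
  have hz : ∀ c : ℝ, ∫⁻ z, ENNReal.ofReal (Real.exp (c * z)) ∂gaussianReal 0 1 =
      ENNReal.ofReal (Real.exp (c ^ 2 / 2)) := by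
    intro c
    rw [← ofReal_integral_eq_lintegral_ofReal (integrable_exp_mul_gaussianReal c)
      (ae_of_all _ fun _ => (Real.exp_pos _).le)]
    have := congrFun (mgf_id_gaussianReal (μ := 0) (v := 1)) c
    simp only [mgf, id] at this
    rw [this]
    simp
  rw [lintegral_law (by fun_prop)]
  calc _ = ∫⁻ u in Set.Ioi 0, ENNReal.ofReal ((1 - σ ^ 2 * ν / 2) ^ (-(τ / ν))) *
        gammaPDF (τ / ν) (1 / ν - σ ^ 2 / 2) u := by
        refine setLIntegral_congr_fun measurableSet_Ioi fun u (hu : 0 < u) => ?_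
        rw [hz, gammaPDF_of_nonneg hu.le, gammaPDF_of_nonneg hu.le,
          ← ENNReal.ofReal_mul (by positivity), ← ENNReal.ofReal_mul (by positivity), mul_pow,
          Real.sq_sqrt hu.le]
        congr 1
        have e1 : (1 / ν) ^ (τ / ν) =
            (1 - σ ^ 2 * ν / 2) ^ (-(τ / ν)) * (1 / ν - σ ^ 2 / 2) ^ (τ / ν) := by
          rw [Real.rpow_neg hb'.le, ← Real.inv_rpow hb'.le,
            ← Real.mul_rpow (by positivity) hb.le]
          congr 1
          rw [eq_inv_mul_iff_mul_eq₀ hb'.ne']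
          field_simp
        have e2 : Real.exp (-((1 / ν - σ ^ 2 / 2) * u)) =
            Real.exp (-(1 / ν * u)) * Real.exp (σ ^ 2 * u / 2) := by
          rw [← Real.exp_add]; congr 1; ring
        rw [e1, e2]
        ring
    _ = _ := by
        rw [lintegral_const_mul _ (by unfold gammaPDF; fun_prop)]
        have h1 := lintegral_gammaPDF_eq_one hq hb
        have h0 := lintegral_gammaPDF_of_nonpos (x := 0) (a := τ / ν)
          (r := 1 / ν - σ ^ 2 / 2) le_rfl
        rw [← lintegral_add_compl _ (measurableSet_Iio (a := (0 : ℝ))), h0, zero_add,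
          Set.compl_Iio] at h1
        rw [setLIntegral_congr Ioi_ae_eq_Ici, h1, mul_one]

theorem integrable_exp_law {σ ν τ : ℝ} (hν : 0 < ν) (hτ : 0 < τ) (hσν : σ ^ 2 * ν < 2) :
    Integrable Real.exp (law σ ν 0 τ) := by
  refine ⟨Real.measurable_exp.aestronglyMeasurable, ?_⟩
  rw [hasFiniteIntegral_iff_ofReal (ae_of_all _ fun _ => (Real.exp_pos _).le),
    lintegral_exp_law hν hτ hσν]
  exact ENNReal.ofReal_lt_top

theorem integral_exp_law {σ ν τ : ℝ} (hν : 0 < ν) (hτ : 0 < τ) (hσν : σ ^ 2 * ν < 2) :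
    ∫ x, Real.exp x ∂law σ ν 0 τ = (1 - σ ^ 2 * ν / 2) ^ (-(τ / ν)) := by
  have hb' : 0 < 1 - σ ^ 2 * ν / 2 := by linarith
  rw [integral_eq_lintegral_of_nonneg_ae (ae_of_all _ fun _ => (Real.exp_pos _).le)
    Real.measurable_exp.aestronglyMeasurable, lintegral_exp_law hν hτ hσν,
    ENNReal.toReal_ofReal (by positivity)]

/-! ### Call and put integrals, and parity. -/

/-- The truncated exponential moment of the density as a double series. -/
theorem integral_Ioi_symmDensity {α y s : ℝ} (hα : ∀ m : ℤ, α ≠ m) (h : -(1 / 2) < α)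
    (hy : 0 ≤ y) (hs0 : s ≠ 0) (hs1 : |s| < 1) :
    ∫ x in Set.Ioi y, symmDensity α x * (Real.exp (s * (x - y)) - 1) =
      (2 * Real.Gamma (α + 1 / 2))⁻¹ *
        ∑' p : ℕ × ℕ, otmTerm α (-(y * s)) s p.1 (p.2 + 1) := by
  rw [(hasSum_otmTerm hα h hy hs0 hs1).tsum_eq, ← mul_assoc, ← integral_const_mul]
  refine integral_congr_ae (ae_of_all _ fun x => ?_)
  simp only [symmDensity]
  rw [mul_inv, mul_inv, mul_inv]
  ring

theorem integral_call_of_nonpos {σ ν τ α s y : ℝ} (hν : 0 < ν) (hτ : 0 < τ)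
    (hα : α = τ / ν - 1 / 2) (hs : s = σ * √(ν / 2)) (hs0 : 0 < s) (hs1 : s < 1)
    (hαm : ∀ m : ℤ, α ≠ m) (hy : 0 ≤ y) :
    ∫ x, max (Real.exp (-(y * s) + x) - 1) 0 ∂law σ ν 0 τ = (2 * Real.Gamma (α + 1 / 2))⁻¹ *
        ∑' p : ℕ × ℕ, otmTerm α (-(y * s)) s p.1 (p.2 + 1) := by
  have h : -(1 / 2) < α := by
    have : 0 < τ / ν := by positivity
    linarith
  rw [integral_law hν hτ hα hs (by fun_prop),
    ← integral_Ioi_symmDensity hαm h hy hs0.ne' (by rwa [abs_of_pos hs0]),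
    ← integral_indicator measurableSet_Ioi]
  refine integral_congr_ae (ae_of_all _ fun x => ?_)
  have e : -(y * s) + s * x = s * (x - y) := by ring
  by_cases hx : x ∈ Set.Ioi y
  · simp only [Set.indicator_of_mem hx, e]
    rw [max_eq_left]
    have : 0 ≤ s * (x - y) := mul_nonneg hs0.le (sub_nonneg.2 (le_of_lt hx))
    linarith [Real.one_le_exp this]
  · simp only [Set.indicator_of_notMem hx, e]
    rw [max_eq_right, mul_zero]
    have : s * (x - y) ≤ 0 := mul_nonpos_of_nonneg_of_nonpos hs0.le (sub_nonpos.2 (not_lt.1 hx))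
    linarith [Real.exp_le_one_iff.2 this]

/-- The density is even, so x ↦ -x moves the exercise region of the put to x > y and replaces s by
-s; the minus sign comes from 1 - exp in place of exp - 1. -/
theorem integral_put_of_nonneg {σ ν τ α s y : ℝ} (hν : 0 < ν) (hτ : 0 < τ)
    (hα : α = τ / ν - 1 / 2) (hs : s = σ * √(ν / 2)) (hs0 : 0 < s) (hs1 : s < 1)
    (hαm : ∀ m : ℤ, α ≠ m) (hy : 0 ≤ y) :
    ∫ x, max (1 - Real.exp (y * s + x)) 0 ∂law σ ν 0 τ = -((2 * Real.Gamma (α + 1 / 2))⁻¹ *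
        ∑' p : ℕ × ℕ, otmTerm α (y * s) (-s) p.1 (p.2 + 1)) := by
  have h : -(1 / 2) < α := by
    have : 0 < τ / ν := by positivity
    linarith
  have key := integral_Ioi_symmDensity hαm h hy (s := -s) (neg_ne_zero.2 hs0.ne')
    (by rwa [abs_neg, abs_of_pos hs0])
  rw [mul_neg, neg_neg] at key
  rw [integral_law hν hτ hα hs (by fun_prop), ← key, ← integral_neg_eq_self,
    ← integral_indicator measurableSet_Ioi, ← integral_neg]
  refine integral_congr_ae (ae_of_all _ fun x => ?_)
  have e : y * s + s * -x = -s * (x - y) := by ring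
  simp only [e, symmDensity_neg]
  by_cases hx : x ∈ Set.Ioi y
  · simp only [Set.indicator_of_mem hx]
    have : -s * (x - y) ≤ 0 := by
      nlinarith [mul_nonneg hs0.le (sub_nonneg.2 (le_of_lt hx))]
    rw [max_eq_left (by linarith [Real.exp_le_one_iff.2 this])]
    ring
  · simp only [Set.indicator_of_notMem hx]
    have : 0 ≤ -s * (x - y) := by
      nlinarith [mul_nonneg hs0.le (sub_nonneg.2 (not_lt.1 hx))]
    rw [max_eq_right (by linarith [Real.one_le_exp this])]
    ring

/-- Put-call parity. -/
theorem integral_call_eq_put {σ ν τ : ℝ} (hν : 0 < ν) (hτ : 0 < τ) (hσν : σ ^ 2 * ν < 2)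
    (k : ℝ) :
    ∫ x, max (Real.exp (k + x) - 1) 0 ∂law σ ν 0 τ =
      Real.exp k * (1 - σ ^ 2 * ν / 2) ^ (-(τ / ν)) - 1 +
        ∫ x, max (1 - Real.exp (k + x)) 0 ∂law σ ν 0 τ := by
  have := isProbabilityMeasure_law (σ := σ) hν hτ
  have hi : Integrable (fun x => Real.exp (k + x)) (law σ ν 0 τ) := by
    simp_rw [Real.exp_add]
    exact (integrable_exp_law hν hτ hσν).const_mul _
  have hp : Integrable (fun x => max (1 - Real.exp (k + x)) 0) (law σ ν 0 τ) :=
    ((integrable_const 1).sub hi).pos_part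
  have h1 : ∫ x, (Real.exp (k + x) - 1) ∂law σ ν 0 τ =
      Real.exp k * (1 - σ ^ 2 * ν / 2) ^ (-(τ / ν)) - 1 := by
    rw [integral_sub hi (integrable_const 1)]
    simp_rw [Real.exp_add]
    rw [integral_const_mul, integral_exp_law hν hτ hσν]
    simp
  rw [← h1, ← integral_add (f := fun x => Real.exp (k + x) - 1) (hi.sub (integrable_const 1)) hp]
  refine integral_congr_ae (ae_of_all _ fun x => ?_)
  simp only
  rcases le_total (Real.exp (k + x)) 1 with h | h
  · rw [max_eq_right (by linarith), max_eq_left (by linarith)]; ring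
  · rw [max_eq_left (by linarith), max_eq_right (by linarith)]; ring

/-! ### Conditional expectation of the payoff. -/

/-- Conditional expectation of a function of a measurable variable and an independent one. -/
theorem condExp_comp_of_indep {Ω : Type*} {m mΩ : MeasurableSpace Ω} {Q : Measure Ω}
    [IsProbabilityMeasure Q] (hm : m ≤ mΩ) {U V : Ω → ℝ} (hU : Measurable[m] U)
    (hV : Measurable V) (hind : Indep (MeasurableSpace.comap V inferInstance) m Q)
    {φ : ℝ × ℝ → ℝ} (hφ : Measurable φ) (hint : Integrable (fun w => φ (U w, V w)) Q) :
    Q[fun w => φ (U w, V w) | m] =ᵐ[Q] fun w => ∫ v, φ (U w, v) ∂(Q.map V) := by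
  have := Measure.isProbabilityMeasure_map (μ := Q) hV.aemeasurable
  have hU' : Measurable U := hU.mono hm le_rfl
  have hjoint : ∀ {β : Type} [MeasurableSpace β] {W : Ω → β}, Measurable[m] W →
      Q.map (fun w => (W w, V w)) = (Q.map W).prod (Q.map V) := by
    intro β _ W hW
    refine (indepFun_iff_map_prod_eq_prod_map_map (hW.mono hm le_rfl).aemeasurable
      hV.aemeasurable).1 ?_
    rw [IndepFun_iff_Indep]
    exact indep_of_indep_of_le_left hind.symm hW.comap_le
  have hψ : StronglyMeasurable fun u => ∫ v, φ (u, v) ∂(Q.map V) :=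
    StronglyMeasurable.integral_prod_right (f := fun u v => φ (u, v)) hφ.stronglyMeasurable
  have hprod : Integrable φ ((Q.map U).prod (Q.map V)) := by
    rw [← hjoint hU]
    exact (integrable_map_measure hφ.aestronglyMeasurable (by fun_prop)).2 hint
  have hg : Integrable (fun w => ∫ v, φ (U w, v) ∂(Q.map V)) Q :=
    (integrable_map_measure hψ.aestronglyMeasurable hU'.aemeasurable).1 hprod.integral_prod_left
  refine (ae_eq_condExp_of_forall_setIntegral_eq hm hint (fun _ _ _ => hg.integrableOn) ?_
    (hψ.measurable.comp hU).aestronglyMeasurable).symm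
  intro A hA _
  -- Adjoining the indicator of A to U keeps the pair m-measurable, hence independent of V; testing
  -- against A becomes Fubini on a product measure.
  have hW : Measurable[m] fun w => (U w, A.indicator (fun _ => (1 : ℝ)) w) :=
    hU.prodMk (measurable_const.indicator hA)
  have hW' := hW.mono hm le_rfl
  have hj := hjoint hW
  have hΦ : Measurable fun p : (ℝ × ℝ) × ℝ => p.1.2 * φ (p.1.1, p.2) := by fun_prop
  have hmul : ∀ w, A.indicator (fun _ => (1 : ℝ)) w * φ (U w, V w) =
      A.indicator (fun w => φ (U w, V w)) w := fun w => by
    by_cases hw : w ∈ A <;> simp [hw]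
  have hmul' : ∀ w, A.indicator (fun _ => (1 : ℝ)) w * ∫ v, φ (U w, v) ∂(Q.map V) =
      A.indicator (fun w => ∫ v, φ (U w, v) ∂(Q.map V)) w := fun w => by
    by_cases hw : w ∈ A <;> simp [hw]
  have hWV : Measurable fun w => ((U w, A.indicator (fun _ => (1 : ℝ)) w), V w) :=
    hW'.prodMk hV
  have hI : Integrable (fun p : (ℝ × ℝ) × ℝ => p.1.2 * φ (p.1.1, p.2))
      ((Q.map fun w => (U w, A.indicator (fun _ => (1 : ℝ)) w)).prod (Q.map V)) := by
    rw [← hj]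
    refine (integrable_map_measure hΦ.aestronglyMeasurable hWV.aemeasurable).2 ?_
    exact (hint.indicator (hm A hA)).congr (ae_of_all _ fun w => (hmul w).symm)
  rw [← integral_indicator (hm A hA), ← integral_indicator (hm A hA)]
  simp_rw [← hmul, ← hmul']
  have e1 := integral_map (μ := Q) hWV.aemeasurable
    (f := fun p : (ℝ × ℝ) × ℝ => p.1.2 * φ (p.1.1, p.2)) hΦ.aestronglyMeasurable
  simp only at e1
  rw [← e1, hj, integral_prod _ hI]
  simp only
  simp_rw [integral_const_mul]
  rw [integral_map hW'.aemeasurable]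
  have : Measurable fun p : ℝ × ℝ => p.2 * ∫ v, φ (p.1, v) ∂(Q.map V) :=
    measurable_snd.mul (hψ.measurable.comp measurable_fst)
  exact this.aestronglyMeasurable

theorem measurable_callPayoff (K : ℝ) : Measurable (callPayoff K) := by
  unfold callPayoff; fun_prop

theorem abs_callPayoff_le {K x : ℝ} (hK : 0 < K) (hx : 0 ≤ x) : |callPayoff K x| ≤ x := by
  rw [callPayoff, abs_of_nonneg (le_max_right _ _)]
  exact max_le (by linarith) hx

theorem integrable_callPayoff_law {σ ν τ K : ℝ} (hν : 0 < ν) (hτ : 0 < τ) (hσν : σ ^ 2 * ν < 2)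
    (hK : 0 < K) {S : ℝ} (hS : 0 < S) (c : ℝ) :
    Integrable (fun x => callPayoff K (S * Real.exp (c + x))) (law σ ν 0 τ) := by
  refine ((integrable_exp_law hν hτ hσν).const_mul (S * Real.exp c)).mono'
    ((measurable_callPayoff K).comp (by fun_prop)).aestronglyMeasurable (ae_of_all _ fun x => ?_)
  rw [Real.norm_eq_abs, mul_assoc, ← Real.exp_add]
  exact abs_callPayoff_le hK (by positivity)

/-- The call payoff is integrable in the model and its discounted conditional expectation is the
price at the current spot. -/
theorem condExp_callPayoff {K r τ σ ν : ℝ} (hK : 0 < K) (hτ : 0 < τ)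
    (hν : 0 < ν) (hσν : σ ^ 2 * ν < 2) {Ω : Type*} [mΩ : MeasurableSpace Ω] (Q : Measure Ω)
    [IsProbabilityMeasure Q] (ℱ : Filtration ℝ≥0 mΩ) (X : ℝ≥0 → Ω → ℝ) (S₀ : ℝ) (t T : ℝ≥0)
    (hX : IsVGProcess σ ν 0 Q ℱ X) (hS₀ : 0 < S₀) (hT : (T : ℝ) = t + τ) :
    Integrable (fun w => callPayoff K (stock σ ν 0 r S₀ X T w)) Q ∧
      Q[fun w => Real.exp (-(r * τ)) * callPayoff K (stock σ ν 0 r S₀ X T w) | ℱ t]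
        =ᵐ[Q] fun w => price (callPayoff K) (stock σ ν 0 r S₀ X t w) r τ σ ν 0 := by
  have htT : t < T := by
    rw [← NNReal.coe_lt_coe, hT]; linarith
  have hTpos : 0 < T := zero_le.trans_lt htT
  have hXm : ∀ u, Measurable (X u) := fun u => (hX.adapted u).mono (ℱ.le u) le_rfl
  have hXt : Measurable[ℱ t] (X t) := hX.adapted t
  have hc := measurable_callPayoff K
  have hint : Integrable (fun w => callPayoff K (stock σ ν 0 r S₀ X T w)) Q := by
    -- The law is prescribed for increments only, so X T is first replaced by X T - X 0, almost
    -- surely the same.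
    have h1 : Integrable (fun w => callPayoff K
        (S₀ * Real.exp ((r + omega σ ν 0) * T + (X T w - X 0 w)))) Q := by
      have hl := hX.increments 0 T hTpos
      rw [NNReal.coe_zero, sub_zero] at hl
      have h2 := integrable_callPayoff_law hν (NNReal.coe_pos.2 hTpos) hσν hK hS₀
        ((r + omega σ ν 0) * T)
      rw [← hl] at h2
      exact (integrable_map_measure (hc.comp (by fun_prop)).aestronglyMeasurable
        ((hXm T).sub (hXm 0)).aemeasurable).1 h2
    refine h1.congr ?_
    filter_upwards [hX.zero] with w hw
    rw [stock, hw, Pi.zero_apply, sub_zero]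
  refine ⟨hint, ?_⟩
  have hV : Measurable fun w => X T w - X t w := (hXm T).sub (hXm t)
  have hU : Measurable[ℱ t] (stock σ ν 0 r S₀ X t) := by
    have : Measurable fun x : ℝ => S₀ * Real.exp ((r + omega σ ν 0) * t + x) := by fun_prop
    exact this.comp hXt
  set φ : ℝ × ℝ → ℝ := fun p => Real.exp (-(r * τ)) *
    callPayoff K (p.1 * Real.exp ((r + omega σ ν 0) * τ + p.2)) with hφ
  have hφm : Measurable φ := (hc.comp (by fun_prop)).const_mul _
  -- The terminal price is the current price times the exponential of a drift and of an increment
  -- independent of the past.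
  have e : ∀ w, Real.exp (-(r * τ)) * callPayoff K (stock σ ν 0 r S₀ X T w) =
      φ (stock σ ν 0 r S₀ X t w, X T w - X t w) := by
    intro w
    simp only [hφ, stock]
    rw [mul_assoc S₀, ← Real.exp_add, hT]
    congr 4
    ring
  have hint' : Integrable (fun w => φ (stock σ ν 0 r S₀ X t w, X T w - X t w)) Q :=
    (hint.const_mul _).congr (ae_of_all _ e)
  simp_rw [e]
  refine (condExp_comp_of_indep (ℱ.le t) hU hV (hX.indep t T htT.le) hφm hint').trans
    (ae_of_all _ fun w => ?_)
  simp only [hφ, price]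
  rw [hX.increments t T htT, hT, add_sub_cancel_left, integral_const_mul]

/-! ### Pricing formulas in terms of the moneyness. -/

theorem price_callPayoff_eq {S K r τ σ ν : ℝ} (hS : 0 < S) (hK : 0 < K) :
    price (callPayoff K) S r τ σ ν 0 = forwardStrike K r τ *
      ∫ x, max (Real.exp (moneyness S K r τ σ ν + x) - 1) 0 ∂law σ ν 0 τ := by
  rw [price, forwardStrike, mul_comm K, mul_assoc, ← integral_const_mul K]
  congr 1
  refine integral_congr_ae (ae_of_all _ fun x => ?_)
  have e : S * Real.exp ((r + omega σ ν 0) * τ + x) =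
      K * Real.exp (moneyness S K r τ σ ν + x) := by
    rw [moneyness, show Real.log (S / K) + r * τ + omega σ ν 0 * τ + x =
      Real.log (S / K) + ((r + omega σ ν 0) * τ + x) by ring, Real.exp_add (Real.log _),
      Real.exp_log (by positivity)]
    field_simp
  simp only [callPayoff]
  rw [e, mul_max_of_nonneg _ _ hK.le, mul_zero, mul_sub, mul_one]

/-- The martingale property: e^(ωτ) cancels the exponential moment of the law, so the forward term
of put-call parity is S. -/
theorem forwardStrike_mul_exp_moneyness {S K r τ σ ν : ℝ} (hS : 0 < S) (hK : 0 < K)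
    (hν : 0 < ν) (hσν : σ ^ 2 * ν < 2) :
    forwardStrike K r τ * (Real.exp (moneyness S K r τ σ ν) *
      (1 - σ ^ 2 * ν / 2) ^ (-(τ / ν))) = S := by
  have hb : 0 < 1 - σ ^ 2 * ν / 2 := by linarith
  have e : Real.exp (omega σ ν 0 * τ) * (1 - σ ^ 2 * ν / 2) ^ (-(τ / ν)) = 1 := by
    rw [omega, Real.rpow_def_of_pos hb, ← Real.exp_add, Real.exp_eq_one_iff, zero_mul, sub_zero]
    field_simp
    ring
  rw [forwardStrike, moneyness, Real.exp_add, Real.exp_add, Real.exp_log (by positivity),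
    Real.exp_neg]
  have := Real.exp_ne_zero (r * τ)
  calc _ = S * (Real.exp (omega σ ν 0 * τ) * (1 - σ ^ 2 * ν / 2) ^ (-(τ / ν))) := by field_simp
    _ = S := by rw [e, mul_one]

theorem rescaledVol_pos {σ ν : ℝ} (hσ : 0 < σ) (hν : 0 < ν) : 0 < rescaledVol σ ν := by
  rw [rescaledVol]; positivity

theorem rescaledVol_lt_one {σ ν : ℝ} (hν : 0 < ν) (hσν : σ ^ 2 * ν < 2) :
    rescaledVol σ ν < 1 := by
  have h : rescaledVol σ ν ^ 2 < 1 := by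
    rw [rescaledVol, mul_pow, Real.sq_sqrt (by positivity)]; linarith
  nlinarith

/-- The non-strict inequality lets this formula and its in-the-money counterpart both apply at the
money. -/
theorem price_of_moneyness_nonpos
    {S K r τ σ ν : ℝ} (hS : 0 < S) (hK : 0 < K) (hτ : 0 < τ) (hσ : 0 < σ)
    (hν : 0 < ν) (hσν : σ ^ 2 * ν < 2) (hα : ∀ m : ℤ, τ / ν - 1 / 2 ≠ m)
    (hk : moneyness S K r τ σ ν ≤ 0) :
    Summable (fun p : ℕ × ℕ => otmTerm (τ / ν - 1 / 2) (moneyness S K r τ σ ν)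
      (rescaledVol σ ν) p.1 (p.2 + 1)) ∧
    price (callPayoff K) S r τ σ ν 0 = otmCall (forwardStrike K r τ) (τ / ν - 1 / 2)
      (moneyness S K r τ σ ν) (rescaledVol σ ν) := by
  have hs0 := rescaledVol_pos hσ hν
  have hs1 := rescaledVol_lt_one hν hσν
  have h : -(1 / 2) < τ / ν - 1 / 2 := by
    have : 0 < τ / ν := by positivity
    linarith
  have hp := price_callPayoff_eq (r := r) (τ := τ) (σ := σ) (ν := ν) hS hK
  have hy : 0 ≤ -moneyness S K r τ σ ν / rescaledVol σ ν := div_nonneg (by linarith) hs0.le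
  have e : moneyness S K r τ σ ν =
      -(-moneyness S K r τ σ ν / rescaledVol σ ν * rescaledVol σ ν) := by
    field_simp
  generalize moneyness S K r τ σ ν = k at *
  generalize -k / rescaledVol σ ν = y at *
  subst e
  refine ⟨summable_otmTerm hα h hy hs0.ne' (by rwa [abs_of_pos hs0]), ?_⟩
  rw [hp, integral_call_of_nonpos (s := rescaledVol σ ν) hν hτ rfl rfl hs0 hs1 hα hy, otmCall,
    div_eq_mul_inv (forwardStrike K r τ), mul_assoc]

theorem price_of_moneyness_nonneg
    {S K r τ σ ν : ℝ} (hS : 0 < S) (hK : 0 < K) (hτ : 0 < τ) (hσ : 0 < σ)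
    (hν : 0 < ν) (hσν : σ ^ 2 * ν < 2) (hα : ∀ m : ℤ, τ / ν - 1 / 2 ≠ m)
    (hk : 0 ≤ moneyness S K r τ σ ν) :
    Summable (fun p : ℕ × ℕ => otmTerm (τ / ν - 1 / 2) (moneyness S K r τ σ ν)
      (-rescaledVol σ ν) p.1 (p.2 + 1)) ∧
    price (callPayoff K) S r τ σ ν 0 = S - K * Real.exp (-(r * τ)) -
      otmCall (forwardStrike K r τ) (τ / ν - 1 / 2) (moneyness S K r τ σ ν)
        (-rescaledVol σ ν) := by
  have hs0 := rescaledVol_pos hσ hν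
  have hs1 := rescaledVol_lt_one hν hσν
  have h : -(1 / 2) < τ / ν - 1 / 2 := by
    have : 0 < τ / ν := by positivity
    linarith
  have hp := price_callPayoff_eq (r := r) (τ := τ) (σ := σ) (ν := ν) hS hK
  have hf := forwardStrike_mul_exp_moneyness (r := r) (τ := τ) hS hK hν hσν
  have hy : 0 ≤ moneyness S K r τ σ ν / rescaledVol σ ν := div_nonneg hk hs0.le
  have e : moneyness S K r τ σ ν =
      moneyness S K r τ σ ν / rescaledVol σ ν * rescaledVol σ ν := by
    field_simp
  generalize moneyness S K r τ σ ν = k at *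
  generalize k / rescaledVol σ ν = y at *
  subst e
  have hsm := summable_otmTerm hα h hy (s := -rescaledVol σ ν) (neg_ne_zero.2 hs0.ne')
    (by rwa [abs_neg, abs_of_pos hs0])
  rw [mul_neg, neg_neg] at hsm
  refine ⟨hsm, ?_⟩
  rw [hp, integral_call_eq_put hν hτ hσν, integral_put_of_nonneg (s := rescaledVol σ ν) hν
      hτ rfl rfl hs0 hs1 hα hy, mul_add, mul_sub, hf, otmCall, forwardStrike, div_eq_mul_inv]
  ring

/-! ### The at-the-money series. -/

/-- At k = 0 the real power vanishes, its exponent being positive for α > -1/2, and the integer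
power 0^n₁ survives only for n₁ = 0. -/
theorem otmTerm_zero_succ {α s : ℝ} (h : -(1 / 2) < α) (j n : ℕ) :
    otmTerm α 0 s (j + 1) n = 0 := by
  have hj : (0 : ℝ) ≤ j := Nat.cast_nonneg _
  rw [otmTerm, neg_zero, zero_div, zero_pow j.succ_ne_zero, Real.zero_rpow (by
    push_cast
    intro h0
    linarith)]
  simp

theorem otmTerm_zero_zero {α s : ℝ} (h : -(1 / 2) < α) (n : ℕ) :
    otmTerm α 0 s 0 n = atmTerm α s n := by
  rw [otmTerm, neg_zero, zero_div, Real.zero_rpow (by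
    push_cast
    intro h0
    linarith), atmTerm, quot₁]
  simp

theorem tsum_otmTerm_zero {α s : ℝ} (h : -(1 / 2) < α) :
    ∑' p : ℕ × ℕ, otmTerm α 0 s p.1 (p.2 + 1) = ∑' n : ℕ, atmTerm α s (n + 1) := by
  have hi : Function.Injective fun n : ℕ => ((0 : ℕ), n) := fun a b hab => by simpa using hab
  rw [← hi.tsum_eq]
  · exact tsum_congr fun n => otmTerm_zero_zero h _
  · rintro ⟨j, n⟩ hjn
    rcases j with _ | j
    · exact ⟨n, rfl⟩
    · exact absurd (otmTerm_zero_succ h j (n + 1)) hjn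

end VarianceGamma

theorem mainTheorem1 (S K r τ σ ν : ℝ) (hS : 0 < S) (hK : 0 < K) (hτ : 0 < τ) (hσ : 0 < σ)
    (hν : 0 < ν) (hσν : σ ^ 2 * ν < 2) (hα : ∀ m : ℤ, τ / ν - 1 / 2 ≠ m) :
    let α : ℝ := τ / ν - 1 / 2
    let F : ℝ := VarianceGamma.forwardStrike K r τ
    let s : ℝ := VarianceGamma.rescaledVol σ ν
    let k : ℝ := VarianceGamma.moneyness S K r τ σ ν
    let C : ℝ → ℝ := fun x => VarianceGamma.price (VarianceGamma.callPayoff K) x r τ σ ν 0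
    -- the value at time `t` of the call (discounted conditional expectation of its payoff at
    -- `T = t + τ`, in any exponential symmetric VG model) is the price at the current spot
    (∀ {Ω : Type*} [mΩ : MeasurableSpace Ω] (Q : Measure Ω) [IsProbabilityMeasure Q]
      (ℱ : Filtration ℝ≥0 mΩ) (X : ℝ≥0 → Ω → ℝ) (S₀ : ℝ) (t T : ℝ≥0),
      VarianceGamma.IsVGProcess σ ν 0 Q ℱ X → 0 < S₀ → (T : ℝ) = t + τ →
        Integrable (fun w =>
          VarianceGamma.callPayoff K (VarianceGamma.stock σ ν 0 r S₀ X T w)) Q ∧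
        Q[fun w => Real.exp (-(r * τ)) *
            VarianceGamma.callPayoff K (VarianceGamma.stock σ ν 0 r S₀ X T w) | ℱ t]
          =ᵐ[Q] fun w => C (VarianceGamma.stock σ ν 0 r S₀ X t w)) ∧
    Integrable (fun x => VarianceGamma.callPayoff K
      (S * Real.exp ((r + VarianceGamma.omega σ ν 0) * τ + x))) (VarianceGamma.law σ ν 0 τ) ∧
    -- out of the money
    (k < 0 →
      Summable (fun p : ℕ × ℕ => VarianceGamma.otmTerm α k s p.1 (p.2 + 1)) ∧
      C S = VarianceGamma.otmCall F α k s) ∧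
    -- in the money
    (0 < k →
      Summable (fun p : ℕ × ℕ => VarianceGamma.otmTerm α k (-s) p.1 (p.2 + 1)) ∧
      C S = S - K * Real.exp (-(r * τ)) - VarianceGamma.otmCall F α k (-s)) ∧
    -- at the money
    (k = 0 →
      Summable (fun p : ℕ × ℕ => VarianceGamma.otmTerm α 0 s p.1 (p.2 + 1)) ∧
      Summable (fun p : ℕ × ℕ => VarianceGamma.otmTerm α 0 (-s) p.1 (p.2 + 1)) ∧
      Summable (fun n : ℕ => VarianceGamma.atmTerm α s (n + 1)) ∧
      C S = F / (2 * Real.Gamma (τ / ν)) * ∑' n : ℕ, VarianceGamma.atmTerm α s (n + 1) ∧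
      C S = VarianceGamma.otmCall F α 0 s ∧
      C S = S - K * Real.exp (-(r * τ)) - VarianceGamma.otmCall F α 0 (-s)) := by

  have h : -(1 / 2) < τ / ν - 1 / 2 := by
    have : 0 < τ / ν := by positivity
    linarith
  refine ⟨fun Q _ ℱ X S₀ t T hX hS₀ hT =>
    VarianceGamma.condExp_callPayoff hK hτ hν hσν Q ℱ X S₀ t T hX hS₀ hT,
    VarianceGamma.integrable_callPayoff_law hν hτ hσν hK hS _,
    fun hk => VarianceGamma.price_of_moneyness_nonpos hS hK hτ hσ hν hσν hα hk.le,
    fun hk => VarianceGamma.price_of_moneyness_nonneg hS hK hτ hσ hν hσν hα hk.le, fun hk => ?_⟩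
  have hk' : VarianceGamma.moneyness S K r τ σ ν = 0 := hk
  obtain ⟨s1, p1⟩ := VarianceGamma.price_of_moneyness_nonpos hS hK hτ hσ hν hσν hα hk'.le
  obtain ⟨s2, p2⟩ := VarianceGamma.price_of_moneyness_nonneg hS hK hτ hσ hν hσν hα hk'.ge
  rw [hk'] at s1 p1 s2 p2
  refine ⟨s1, s2, ?_, ?_, p1, p2⟩
  -- The single series is the row n₁ = 0 of the double series.
  · refine (s1.comp_injective (i := fun n : ℕ => ((0 : ℕ), n))
      fun a b hab => by simpa using hab).congr fun n => ?_
    exact VarianceGamma.otmTerm_zero_zero h _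
  · change VarianceGamma.price (VarianceGamma.callPayoff K) S r τ σ ν 0 = _
    rw [p1, VarianceGamma.otmCall, VarianceGamma.tsum_otmTerm_zero h, sub_add_cancel]
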